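/- Let $\omega,t>0$ and $g\in\mathbb R$. For $\psi=(\psi_+,\psi_-)\in L^2(\mathbb R,\mathbb C^2)$ with $\psi'\in L^2$ (weak derivative) and $x\psi\in L^2$, and for $\lambda\in\mathbb R$, let $$\langle \hat H_0^\lambda\rangle_\psi=\tfrac12\int|\psi'|^2\,dx+\tfrac{\omega^2}{2}\int x^2|\psi|^2\,dx-2t\,\mathrm{Re}\int\overline{\psi_+}\psi_-\,dx+\lambda g\int x\,(|\psi_+|^2-|\psi_-|^2)\,dx$$ be the energy of the quantum Rabi model with coupling scaled by $\lambda$, where $|\psi|^2=|\psi_+|^2+|\psi_-|^2$ and $|\psi'|^2=|\psi_+'|^2+|\psi_-'|^2$. For $(\sigma,\xi)\in[-1,1]\times\mathbb R$ let $\mathcal M_{\sigma,\xi}$ be the set of all such $\psi$ with $\|\psi\|=1$, $\|\psi_+\|^2-\|\psi_-\|^2=\sigma$ and $\int x|\psi|^2\,dx=\xi$, and let $$F_{\mathrm{LL}}^\lambda(\sigma,\xi)=\inf_{\psi\in\mathcal M_{\sigma,\xi}}\langle\hat H_0^\lambda\rangle_\psi$$ be the Levy--Lieb functional. A minimizer is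 called an optimizer of $F_{\mathrm{LL}}^\lambda(\sigma,\xi)$. Then, for every $\sigma\in[-1,1]$: 1. (Exchange energy.) For every $\xi\in\mathbb R$ the following limit exists and the exchange energy is zero: $$E_{\mathrm x}(\sigma,\xi):=\lim_{\lambda\to0^+}\frac{F_{\mathrm{LL}}^\lambda(\sigma,\xi)-F_{\mathrm{LL}}^0(\sigma,\xi)}{\lambda}-g\sigma\xi=0.$$ 2. (Correlation energy.) For every $\nu\in\mathbb R$ there is an optimizer of $F_{\mathrm{LL}}^\nu(\sigma,0)$ with real-valued, non-negative components. Let $\lambda\ge0$ and let $\varphi^\nu$, $\nu\in[0,\lambda]$, be any choice of such optimizers. Then $\nu\mapsto\int(\varphi_+^\nu)'\varphi_-^\nu\,dx$ is integrable on $[0,\lambda]$, and, with $$I^\lambda(\sigma):=-\frac{4tg}{\omega^2}\int_0^\lambda\int(\varphi^\nu_+)'\varphi^\nu_-\,dx\,d\nu,$$ the correlation energy $\lambda G^\lambda(\sigma):=F_{\mathrm{LL}}^\lambda(\sigma,\xi)-F_{\mathrm{LL}}^0(\sigma,\xi)-\lambda g\sigma\xi$ satisfies, for every $\xi\in\mathbb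 R$ (in particular it does not depend on $\xi$), $$\lambda G^\lambda(\sigma)=-\frac{\lambda^2g^2}{2\omega^2}(1-\sigma^2)+I^\lambda(\sigma).$$ -/

import Mathlib

open MeasureTheory Set Filter Topology
open scoped ComplexConjugate

namespace QuantumRabi

/-! ### Weak derivatives on the real line -/

/-- `u'` is a weak derivative of `u : ℝ → ℂ`: both are locally integrable and
`∫ η' u = - ∫ η u'` for every real test function `η ∈ C_c^∞(ℝ)`. -/
def IsWeakDeriv (u u' : ℝ → ℂ) : Prop :=
  LocallyIntegrable u ∧ LocallyIntegrable u' ∧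
    ∀ η : ℝ → ℝ, ContDiff ℝ ((⊤ : ℕ∞) : WithTop ℕ∞) η → HasCompactSupport η →
      ∫ x, deriv η x • u x = - ∫ x, η x • u' x

/-- Weak derivatives are unique almost everywhere. -/
theorem IsWeakDeriv.ae_eq {u v w : ℝ → ℂ} (hv : IsWeakDeriv u v) (hw : IsWeakDeriv u w) :
    v =ᵐ[volume] w := by
  refine ae_eq_of_integral_contDiff_smul_eq hv.2.1 hw.2.1 ?_
  intro η hη hc
  have h := (hv.2.2 η hη hc).symm.trans (hw.2.2 η hη hc)
  exact neg_injective h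

open Classical in
/-- The weak derivative of `u` (determined up to a null set); `0` if there is none. -/
noncomputable def weakDeriv (u : ℝ → ℂ) : ℝ → ℂ :=
  if h : ∃ u', IsWeakDeriv u u' then h.choose else 0

theorem IsWeakDeriv.weakDeriv_ae_eq {u v : ℝ → ℂ} (hv : IsWeakDeriv u v) :
    weakDeriv u =ᵐ[volume] v := by
  have h : ∃ u', IsWeakDeriv u u' := ⟨v, hv⟩
  rw [weakDeriv, dif_pos h]
  exact h.choose_spec.ae_eq hv

/-! ### Wave functions, admissible states, expectation values -/

/-- A two-component wave function `ψ = (ψ₊, ψ₋)`, in the eigenbasis of `σ_z`. -/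
structure Wavefunction where
  /-- the component `ψ₊` -/
  plus : ℝ → ℂ
  /-- the component `ψ₋` -/
  minus : ℝ → ℂ

/-- Finite oscillator energy of one component: `u`, its weak derivative and `x u` are in `L²`. -/
def FiniteEnergy (u : ℝ → ℂ) : Prop :=
  MemLp u 2 ∧ (∃ u', IsWeakDeriv u u' ∧ MemLp u' 2) ∧ MemLp (fun x : ℝ => (x : ℂ) * u x) 2

namespace Wavefunction

/-- Membership in the form domain `Q₀`: `ψ ∈ L²(ℝ, ℂ²)` with `‖p ψ‖, ‖x ψ‖ < ∞`. -/
def Admissible (ψ : Wavefunction) : Prop :=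
  FiniteEnergy ψ.plus ∧ FiniteEnergy ψ.minus

/-- `‖ψ‖² = ‖ψ₊‖² + ‖ψ₋‖²`. -/
noncomputable def normSq (ψ : Wavefunction) : ℝ :=
  (∫ x, ‖ψ.plus x‖ ^ 2) + ∫ x, ‖ψ.minus x‖ ^ 2

/-- The polarization `σ_ψ = ⟨σ_z⟩ = ‖ψ₊‖² - ‖ψ₋‖²`. -/
noncomputable def polarization (ψ : Wavefunction) : ℝ :=
  (∫ x, ‖ψ.plus x‖ ^ 2) - ∫ x, ‖ψ.minus x‖ ^ 2

/-- The displacement `ξ_ψ = ⟨x⟩ = ∫ x |ψ|²`. -/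
noncomputable def displacement (ψ : Wavefunction) : ℝ :=
  ∫ x, x * (‖ψ.plus x‖ ^ 2 + ‖ψ.minus x‖ ^ 2)

/-- `⟨p²⟩ = ‖p ψ‖² = ∫ |ψ'|²`. -/
noncomputable def expPSq (ψ : Wavefunction) : ℝ :=
  ∫ x, (‖weakDeriv ψ.plus x‖ ^ 2 + ‖weakDeriv ψ.minus x‖ ^ 2)

/-- `⟨x²⟩ = ‖x ψ‖² = ∫ x² |ψ|²`. -/
noncomputable def expXSq (ψ : Wavefunction) : ℝ :=
  ∫ x, x ^ 2 * (‖ψ.plus x‖ ^ 2 + ‖ψ.minus x‖ ^ 2)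

/-- `⟨σ_x⟩ = 2 Re ∫ conj ψ₊ ψ₋`. -/
noncomputable def expSigmaX (ψ : Wavefunction) : ℝ :=
  2 * (∫ x, conj (ψ.plus x) * ψ.minus x).re

/-- `⟨σ_z x⟩ = ∫ x (|ψ₊|² - |ψ₋|²)`. -/
noncomputable def expSigmaZX (ψ : Wavefunction) : ℝ :=
  ∫ x, x * (‖ψ.plus x‖ ^ 2 - ‖ψ.minus x‖ ^ 2)

/-- Both components are real-valued and non-negative (almost everywhere). -/
def RealNonneg (ψ : Wavefunction) : Prop :=
  (∀ᵐ x : ℝ, (ψ.plus x).im = 0 ∧ 0 ≤ (ψ.plus x).re) ∧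
    ∀ᵐ x : ℝ, (ψ.minus x).im = 0 ∧ 0 ≤ (ψ.minus x).re

end Wavefunction

/-- The quadratic form `⟨H₀^l⟩_ψ` of
`H₀^l = p²/2 + (ω²/2) x² - t σ_x + l g σ_z x` (coupling scaled by `l`). -/
noncomputable def internalEnergy (ω t g l : ℝ) (ψ : Wavefunction) : ℝ :=
  1 / 2 * ψ.expPSq + ω ^ 2 / 2 * ψ.expXSq - t * ψ.expSigmaX + l * g * ψ.expSigmaZX

/-- The constraint manifold: normalized admissible states with polarization `σ` and
displacement `ξ`. -/
def constraintManifold (σ ξ : ℝ) : Set Wavefunction :=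
  {ψ | ψ.Admissible ∧ ψ.normSq = 1 ∧ ψ.polarization = σ ∧ ψ.displacement = ξ}

/-! ### The Levy–Lieb functional and the adiabatic connection -/

/-- The Levy–Lieb functional `F_LL^l(σ, ξ)`. -/
noncomputable def levyLieb (ω t g l σ ξ : ℝ) : ℝ :=
  sInf (internalEnergy ω t g l '' constraintManifold σ ξ)

/-- `ψ` is a real-valued, non-negative optimizer of `F_LL^l(σ, ξ)`. -/
def IsOptimizer (ω t g l σ ξ : ℝ) (ψ : Wavefunction) : Prop :=
  ψ ∈ constraintManifold σ ξ ∧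
    (∀ χ ∈ constraintManifold σ ξ, internalEnergy ω t g l ψ ≤ internalEnergy ω t g l χ) ∧
    ψ.RealNonneg

/-- The direct-coupling term `D(σ, ξ) = g σ ξ`. -/
def directTerm (g σ ξ : ℝ) : ℝ := g * σ * ξ

/-- `e` is the exchange energy at `(σ, ξ)`: the right derivative of `l ↦ F_LL^l(σ, ξ)` at `l = 0`
exists, and `e` is this derivative minus the direct term. -/
def IsExchangeEnergy (ω t g σ ξ e : ℝ) : Prop :=
  ∃ d : ℝ, Tendsto (fun l : ℝ => (levyLieb ω t g l σ ξ - levyLieb ω t g 0 σ ξ) / l)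
      (𝓝[>] 0) (𝓝 d) ∧ e = d - directTerm g σ ξ

/-- The correlation energy `l G^l = F_LL^l(σ, ξ) - F_LL^0(σ, ξ) - l D(σ, ξ)`. -/
noncomputable def correlationEnergy (ω t g l σ ξ : ℝ) : ℝ :=
  levyLieb ω t g l σ ξ - levyLieb ω t g 0 σ ξ - l * directTerm g σ ξ

/-- `∫ ψ₊' ψ₋ dx`, a real number for states with real-valued components. -/
noncomputable def hoppingOverlap (ψ : Wavefunction) : ℝ :=
  (∫ x, weakDeriv ψ.plus x * ψ.minus x).re

/-- `I^l = -(4 t g / ω²) ∫_0^l ∫ (φ^ν)₊' (φ^ν)₋ dx dν` for a family `φ` of states; it is used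
for the optimizers `φ^ν` of `F_LL^ν(σ, 0)`. -/
noncomputable def correlationIntegral (ω t g : ℝ) (φ : ℝ → Wavefunction) (l : ℝ) : ℝ :=
  -(4 * t * g / ω ^ 2) * ∫ ν in (0 : ℝ)..l, hoppingOverlap (φ ν)

end QuantumRabi

namespace QuantumRabi

open scoped InnerProductSpace

/-! ### Weak sequential compactness in Hilbert spaces -/

section Weak

variable {E : Type*} [NormedAddCommGroup E] [InnerProductSpace ℂ E]

/-! A common translation of both components is a bijection between the constraint sets at
displacements `0` and `ξ` and changes the energy by a constant, so `F^l(σ, ξ) = F^l(σ, 0) + ω²ξ²/2 +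
l g σ ξ` (`IsMinimizer.levyLieb_eq`). It remains to study `f(l) = F^l(σ, 0)`.

Exchange: completing the square in two oscillators displaced in opposite directions gives `f(l) ≥
ω/2 - t√(1-σ²) - l²g²/(2ω²)` (`Feasible.le_energy`). One Gaussian shared by the components with
suitable weights gives `f(l) ≤ ω/2 - t√(1-σ²)` for every `l` (`exists_feasible_energy_eq`). Hence
`f(l) - f(0) = O(l²)`.

Correlation: the energy is affine in `l`, so `g⟨σ_z x⟩` at an optimizer is a supergradient of `f`.
Any selection of supergradients is monotone and integrates to `f(l) - f(0)`
(`integral_supergradient`). Translating the components against each other, with the constraints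
preserved, gives the Euler–Lagrange identity `ω²⟨σ_z x⟩ = -ν g (1-σ²) - 4t ∫ φ₊' φ₋`
(`stationarity`). Its integral over `ν` is the formula.

Optimizers exist by the direct method. A function has a derivative in `L²` exactly when its
translation orbit is Lipschitz; this criterion yields both the Rellich-type compactness and the fact
that passing to absolute values does not raise the kinetic energy. -/

/-- Sequential Banach–Alaoglu in the dual, carried back by the Riesz isomorphism; the latter is
conjugate-linear, hence the conjugations. -/
theorem exists_weakly_convergent_subseq [CompleteSpace E] [SecondCountableTopology E]
    {x : ℕ → E} {C : ℝ} (hx : ∀ n, ‖x n‖ ≤ C) :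
    ∃ (a : E) (φ : ℕ → ℕ), StrictMono φ ∧
      ∀ y, Tendsto (fun n => ⟪y, x (φ n)⟫_ℂ) atTop (𝓝 ⟪y, a⟫_ℂ) := by
  have hc := WeakDual.isSeqCompact_closedBall ℂ E (0 : StrongDual ℂ E) C
  let F : ℕ → WeakDual ℂ E := fun n =>
    StrongDual.toWeakDual (InnerProductSpace.toDual ℂ E (x n))
  have hF : ∀ n, F n ∈ WeakDual.toStrongDual ⁻¹' Metric.closedBall (0 : StrongDual ℂ E) C := by
    intro n
    simpa [F] using hx n
  obtain ⟨a, -, φ, hφ, hlim⟩ := hc hF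
  refine ⟨(InnerProductSpace.toDual ℂ E).symm (WeakDual.toStrongDual a), φ, hφ, fun y => ?_⟩
  have h1 := ((WeakDual.eval_continuous y).tendsto a).comp hlim
  have h2 := (Complex.continuous_conj.tendsto _).comp h1
  have h3 : ⟪y, (InnerProductSpace.toDual ℂ E).symm (WeakDual.toStrongDual a)⟫_ℂ
      = conj (a y) := by
    rw [← inner_conj_symm, InnerProductSpace.toDual_symm_apply]
    rfl
  rw [h3]
  refine h2.congr fun n => ?_
  change conj (⟪x (φ n), y⟫_ℂ) = _
  rw [inner_conj_symm]

/-- Pair with `a` itself and use Cauchy–Schwarz. The bound may vary with `n`, which gives lower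
semicontinuity along convergent norms. -/
theorem norm_le_of_weak_limit {x : ℕ → E} {a : E} {r : ℕ → ℝ} {c : ℝ}
    (hw : ∀ y, Tendsto (fun n => ⟪y, x n⟫_ℂ) atTop (𝓝 ⟪y, a⟫_ℂ))
    (hr : ∀ n, ‖x n‖ ≤ r n) (hc : Tendsto r atTop (𝓝 c)) : ‖a‖ ≤ c := by
  have h1 : ‖a‖ * ‖a‖ ≤ ‖a‖ * c := by
    have h2 : ‖⟪a, a⟫_ℂ‖ ≤ ‖a‖ * c := by
      refine le_of_tendsto_of_tendsto (hw a).norm (hc.const_mul ‖a‖) (Eventually.of_forall ?_)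
      intro n
      exact (norm_inner_le_norm a (x n)).trans (mul_le_mul_of_nonneg_left (hr n) (norm_nonneg _))
    rwa [← inner_self_re_eq_norm, inner_self_eq_norm_mul_norm] at h2
  rcases (norm_nonneg a).eq_or_lt with h0 | h0
  · rw [← h0]
    exact ge_of_tendsto hc (Eventually.of_forall fun n => (norm_nonneg _).trans (hr n))
  · exact le_of_mul_le_mul_left h1 h0

theorem tendsto_inner_of_tendsto_of_weak {x y : ℕ → E} {a b : E} {C : ℝ}
    (hx : Tendsto x atTop (𝓝 a)) (hy : ∀ n, ‖y n‖ ≤ C)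
    (hw : ∀ z, Tendsto (fun n => ⟪z, y n⟫_ℂ) atTop (𝓝 ⟪z, b⟫_ℂ)) :
    Tendsto (fun n => ⟪x n, y n⟫_ℂ) atTop (𝓝 ⟪a, b⟫_ℂ) := by
  have h1 : Tendsto (fun n => ⟪x n - a, y n⟫_ℂ) atTop (𝓝 0) := by
    have h0 : Tendsto (fun n => ‖x n - a‖ * C) atTop (𝓝 0) := by
      simpa using (tendsto_iff_norm_sub_tendsto_zero.1 hx).mul_const C
    refine squeeze_zero_norm (fun n => ?_) h0
    exact (norm_inner_le_norm _ _).trans (mul_le_mul_of_nonneg_left (hy n) (norm_nonneg _))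
  have h2 := h1.add (hw a)
  rw [zero_add] at h2
  refine h2.congr fun n => ?_
  rw [← inner_add_left, sub_add_cancel]

end Weak

/-! ### The translation group on `L²(ℝ)` -/

/-- The Hilbert space `L²(ℝ, ℂ)`. -/
abbrev L2 : Type := Lp ℂ 2 (volume : Measure ℝ)

/-- Translation `f ↦ f(· + s)` on `L²`. -/
noncomputable def shift (s : ℝ) : L2 →ₗᵢ[ℂ] L2 :=
  Lp.compMeasurePreservingₗᵢ ℂ (fun x : ℝ => x + s) (measurePreserving_add_right volume s)

theorem shift_coeFn (s : ℝ) (f : L2) : shift s f =ᵐ[volume] fun x => f (x + s) :=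
  Lp.coeFn_compMeasurePreserving f (measurePreserving_add_right volume s)

theorem ae_comp_add {P : ℝ → Prop} (h : ∀ᵐ x : ℝ, P x) (s : ℝ) : ∀ᵐ x : ℝ, P (x + s) :=
  (measurePreserving_add_right volume s).quasiMeasurePreserving.ae h

theorem shift_zero (f : L2) : shift 0 f = f := by
  refine Lp.ext ?_
  filter_upwards [shift_coeFn 0 f] with x hx
  rw [hx, add_zero]

theorem shift_shift (s r : ℝ) (f : L2) : shift s (shift r f) = shift (s + r) f := by
  refine Lp.ext ?_
  filter_upwards [shift_coeFn s (shift r f), shift_coeFn (s + r) f,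
    ae_comp_add (shift_coeFn r f) s] with x h1 h2 h3
  rw [h1, h2, h3, add_assoc]

theorem continuous_shift (f : L2) : Continuous fun s => shift s f := by
  let g : C(ℝ, C(ℝ, ℝ)) := (ContinuousMap.mk (fun a : ℝ × ℝ => a.2 + a.1)
    (by fun_prop)).curry
  exact Continuous.compMeasurePreservingLp (p := 2) (μ := volume) (ν := volume) (g := fun s => g s)
    (f := fun _ : ℝ => f) continuous_const g.continuous
    (fun s => measurePreserving_add_right (volume : Measure ℝ) s) (by simp)

/-- `p` is the derivative of `u` in the sense of the translation group. -/
def HasGen (u p : L2) : Prop := HasDerivAt (fun s => shift s u) p 0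

theorem HasGen.hasDerivAt {u p : L2} (h : HasGen u p) (s : ℝ) :
    HasDerivAt (fun r => shift r u) (shift s p) s := by
  have h0 : HasDerivAt (fun r => shift (r - s) u) p s :=
    HasDerivAt.comp_sub_const s s (f := fun r => shift r u) (by simpa [HasGen] using h)
  have h1 := (((shift s).toContinuousLinearMap).restrictScalars ℝ).hasFDerivAt.comp_hasDerivAt s h0
  refine h1.congr_of_eventuallyEq (Eventually.of_forall fun r => ?_)
  change shift r u = shift s (shift (r - s) u)
  rw [shift_shift]
  congr 1
  ring_nf

/-- Mean value inequality: the orbit has derivative `shift r p`, of constant norm. The converse is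
`exists_hasGen_of_lipschitz`. -/
theorem HasGen.norm_shift_sub_le {u p : L2} (h : HasGen u p) (s : ℝ) :
    ‖shift s u - u‖ ≤ |s| * ‖p‖ := by
  have := Convex.norm_image_sub_le_of_norm_hasDerivWithin_le (f := fun r => shift r u)
    (s := univ) (x := 0) (y := s) (C := ‖p‖)
    (fun r _ => (h.hasDerivAt r).hasDerivWithinAt) (fun r _ => by simp)
    convex_univ trivial trivial
  simpa [shift_zero, mul_comm] using this

theorem HasGen.shift {u p : L2} (h : HasGen u p) (s : ℝ) :
    HasGen (shift s u) (shift s p) := by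
  have h1 :=
    ((QuantumRabi.shift s).toContinuousLinearMap.restrictScalars ℝ).hasFDerivAt.comp_hasDerivAt 0 h
  refine h1.congr_of_eventuallyEq (Eventually.of_forall fun r => ?_)
  change QuantumRabi.shift r (QuantumRabi.shift s u) = QuantumRabi.shift s (QuantumRabi.shift r u)
  rw [shift_shift, shift_shift, add_comm]

theorem HasGen.smul {u p : L2} (h : HasGen u p) (c : ℂ) : HasGen (c • u) (c • p) := by
  have h1 := HasDerivAt.const_smul c h
  refine h1.congr_of_eventuallyEq (Eventually.of_forall fun r => ?_)
  simp

/-! ### Test functions -/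

/-- Smooth compactly supported real functions, as elements of `L²`. -/
structure Test where
  /-- the underlying function -/
  toFun : ℝ → ℝ
  contDiff : ContDiff ℝ ((⊤ : ℕ∞) : WithTop ℕ∞) toFun
  compact : HasCompactSupport toFun

namespace Test

theorem memLp (η : Test) : MemLp (fun x => (η.toFun x : ℂ)) 2 (volume : Measure ℝ) := by
  refine Continuous.memLp_of_hasCompactSupport ?_ ?_
  · exact Complex.continuous_ofReal.comp η.contDiff.continuous
  · exact η.compact.comp_left (g := fun y : ℝ => (y : ℂ)) (by simp)

/-- The class of a test function in `L²`. -/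
noncomputable def toL2 (η : Test) : L2 := η.memLp.toLp _

/-- The derivative of a test function. -/
noncomputable def derivative (η : Test) : Test where
  toFun := deriv η.toFun
  contDiff := by
    have := η.contDiff
    exact (contDiff_infty_iff_deriv.1 this).2
  compact := η.compact.deriv

theorem inner_toL2 (η : Test) (f : L2) : ⟪η.toL2, f⟫_ℂ = ∫ x, η.toFun x • f x := by
  rw [L2.inner_def]
  refine integral_congr_ae ?_
  filter_upwards [η.memLp.coeFn_toLp] with x hx
  rw [Test.toL2, hx]
  simp [mul_comm]

end Test

theorem L2.locallyIntegrable (f : L2) : LocallyIntegrable f :=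
  (Lp.memLp f).locallyIntegrable (by norm_num)

theorem L2.ext_test {f f' : L2} (h : ∀ η : Test, ⟪η.toL2, f⟫_ℂ = ⟪η.toL2, f'⟫_ℂ) : f = f' := by
  refine Lp.ext ?_
  refine ae_eq_of_integral_contDiff_smul_eq (L2.locallyIntegrable f) (L2.locallyIntegrable f') ?_
  intro η h1 h2
  have := h ⟨η, h1, h2⟩
  rwa [Test.inner_toL2, Test.inner_toL2] at this

theorem Test.inner_shift (η : Test) (f : L2) (s : ℝ) :
    ⟪η.toL2, shift s f⟫_ℂ = ∫ x, η.toFun (x - s) • f x := by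
  rw [Test.inner_toL2]
  have h1 : ∫ x, η.toFun x • shift s f x = ∫ x, η.toFun (x + s - s) • f (x + s) := by
    refine integral_congr_ae ?_
    filter_upwards [shift_coeFn s f] with x hx
    rw [hx, add_sub_cancel_right]
  rw [h1, integral_add_right_eq_self (fun x => η.toFun (x - s) • f x)]

/-- The pairing is a convolution of `f` with the reflected test function, so it is differentiable
for every `f` in `L²`, the derivative falling on `η`. -/
theorem hasDerivAt_inner_shift (η : Test) (f : L2) (s : ℝ) :
    HasDerivAt (fun r => ⟪η.toL2, shift r f⟫_ℂ) (-⟪η.derivative.toL2, shift s f⟫_ℂ) s := by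
  have hc : HasCompactSupport (fun x => η.toFun (-x)) :=
    η.compact.comp_homeomorph (Homeomorph.neg ℝ)
  have hd : ContDiff ℝ 1 (fun x => η.toFun (-x)) :=
    (η.contDiff.of_le (by simp)).comp contDiff_neg
  have h := HasCompactSupport.hasDerivAt_convolution_right
    (ContinuousLinearMap.lsmul ℝ ℝ (E := ℂ)).flip (μ := volume)
    (L2.locallyIntegrable f) hc hd s
  have e1 : (fun r => ⟪η.toL2, shift r f⟫_ℂ) =
      convolution (f : ℝ → ℂ) (fun x => η.toFun (-x))
        (ContinuousLinearMap.lsmul ℝ ℝ (E := ℂ)).flip volume := by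
    funext r
    rw [Test.inner_shift, convolution_def]
    simp
  have e2 : -⟪η.derivative.toL2, shift s f⟫_ℂ =
      convolution (f : ℝ → ℂ) (deriv fun x => η.toFun (-x))
        (ContinuousLinearMap.lsmul ℝ ℝ (E := ℂ)).flip volume s := by
    rw [Test.inner_shift, convolution_def, ← integral_neg]
    refine integral_congr_ae (Eventually.of_forall fun x => ?_)
    simp [deriv_comp_neg, Test.derivative]
  rw [e1, e2]
  exact h

/-! ### Weak derivatives and the generator of translations -/

/-- Tested against `η`, the orbit of `u` has derivative `shift s p`. Integration gives `shift s u =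
u + ∫₀ˢ shift r p` in `L²`, and continuity of the orbit of `p` makes the right side norm
differentiable. -/
theorem IsWeakDeriv.hasGen {u p : L2} (h : IsWeakDeriv u p) : HasGen u p := by
  have key : ∀ (η : Test) (s : ℝ), HasDerivAt (fun r => ⟪η.toL2, shift r u⟫_ℂ)
      ⟪η.toL2, shift s p⟫_ℂ s := by
    intro η s
    have h1 := hasDerivAt_inner_shift η u s
    convert h1 using 1
    rw [Test.inner_shift, Test.inner_shift]
    have hs : ContDiff ℝ ((⊤ : ℕ∞) : WithTop ℕ∞) (fun x => η.toFun (x - s)) :=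
      η.contDiff.comp (contDiff_id.sub contDiff_const)
    have hcs : HasCompactSupport (fun x => η.toFun (x - s)) :=
      η.compact.comp_homeomorph (Homeomorph.subRight s)
    have h2 := h.2.2 _ hs hcs
    have h3 : deriv (fun x => η.toFun (x - s)) = fun x => deriv η.toFun (x - s) := by
      funext x
      exact deriv_comp_sub_const _ _ _
    rw [h3] at h2
    change _ = -∫ x, deriv η.toFun (x - s) • u x
    rw [h2, neg_neg]
  have hint : ∀ s, shift s u = u + ∫ r in (0 : ℝ)..s, shift r p := by
    intro s
    refine L2.ext_test fun η => ?_
    have h1 : ∫ r in (0 : ℝ)..s, ⟪η.toL2, shift r p⟫_ℂ =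
        ⟪η.toL2, shift s u⟫_ℂ - ⟪η.toL2, shift 0 u⟫_ℂ :=
      intervalIntegral.integral_eq_sub_of_hasDerivAt (fun r _ => key η r)
        (Continuous.intervalIntegrable (continuous_const.inner (continuous_shift p)) _ _)
    have h2 := (innerSL ℂ η.toL2).intervalIntegral_comp_comm
      ((continuous_shift p).intervalIntegrable (μ := volume) 0 s)
    simp only [innerSL_apply_apply] at h2
    rw [inner_add_right, ← h2, h1, shift_zero]
    ring
  have h3 : HasDerivAt (fun s => ∫ r in (0 : ℝ)..s, shift r p) (shift 0 p) 0 :=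
    intervalIntegral.integral_hasDerivAt_right ((continuous_shift p).intervalIntegrable _ _)
      ((continuous_shift p).stronglyMeasurableAtFilter _ _) (continuous_shift p).continuousAt
  rw [shift_zero] at h3
  exact (h3.const_add u).congr_of_eventuallyEq (Eventually.of_forall hint)

theorem HasGen.isWeakDeriv {u p : L2} (h : HasGen u p) : IsWeakDeriv u p := by
  refine ⟨L2.locallyIntegrable u, L2.locallyIntegrable p, fun η h1 h2 => ?_⟩
  have e1 := hasDerivAt_inner_shift ⟨η, h1, h2⟩ u 0
  have e2 := (((innerSL ℂ (Test.mk η h1 h2).toL2)).restrictScalars ℝ).hasFDerivAt.comp_hasDerivAt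
    0 h
  have e3 := e1.unique e2
  simp only [shift_zero] at e3
  change _ = ⟪(Test.mk η h1 h2).toL2, p⟫_ℂ at e3
  rw [Test.inner_toL2, Test.inner_toL2] at e3
  rw [← e3, neg_neg]
  rfl

instance : SecondCountableTopology L2 :=
  haveI : Fact ((2 : ENNReal) ≠ ⊤) := ⟨by simp⟩
  inferInstance

/-- The difference quotients are bounded by `C`; a weak limit point of them is a weak derivative,
hence the generator, and inherits the bound. -/
theorem exists_hasGen_of_lipschitz {u : L2} {C : ℝ} (h : ∀ s, ‖shift s u - u‖ ≤ |s| * C) :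
    ∃ p, HasGen u p ∧ ‖p‖ ≤ C := by
  let ε : ℕ → ℝ := fun n => 1 / ((n : ℝ) + 1)
  have hε : ∀ n, 0 < ε n := fun n => by positivity
  let x : ℕ → L2 := fun n => (((ε n)⁻¹ : ℝ) : ℂ) • (shift (ε n) u - u)
  have hx : ∀ n, ‖x n‖ ≤ C := by
    intro n
    have := h (ε n)
    rw [abs_of_pos (hε n)] at this
    simp only [x]
    rw [norm_smul, Complex.norm_real, Real.norm_of_nonneg (inv_nonneg.2 (hε n).le),
      inv_mul_le_iff₀ (hε n)]
    exact this
  obtain ⟨p, φ, hφ, hw⟩ := exists_weakly_convergent_subseq hx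
  refine ⟨p, ?_, norm_le_of_weak_limit hw (fun n => hx _) tendsto_const_nhds⟩
  apply IsWeakDeriv.hasGen
  refine ⟨L2.locallyIntegrable u, L2.locallyIntegrable p, fun η h1 h2 => ?_⟩
  have e1 := hasDerivAt_inner_shift ⟨η, h1, h2⟩ u 0
  have hε0 : Tendsto ε atTop (𝓝[≠] 0) := by
    refine tendsto_nhdsWithin_iff.2 ⟨tendsto_one_div_add_atTop_nhds_zero_nat, ?_⟩
    exact Eventually.of_forall fun n => (hε n).ne'
  have e2 := (hasDerivAt_iff_tendsto_slope.1 e1).comp (hε0.comp hφ.tendsto_atTop)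
  have e3 := tendsto_nhds_unique (hw (Test.mk η h1 h2).toL2) (e2.congr fun n => ?_)
  · rw [shift_zero, Test.inner_toL2, Test.inner_toL2] at e3
    change ∫ x, η x • p x = -∫ x, deriv η x • u x at e3
    rw [e3, neg_neg]
  · simp only [x, Function.comp, slope, sub_zero, vsub_eq_sub, shift_zero]
    rw [← inner_sub_right, ← Complex.coe_smul, inner_smul_right, smul_eq_mul]

/-! ### The position operator -/

/-- `q` is the class of `x ↦ x u(x)`. -/
def IsMulX (u q : L2) : Prop := q =ᵐ[volume] fun x : ℝ => (x : ℂ) * u x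

/-- This is `x u(x+s) = (x+s) u(x+s) - s u(x+s)`. -/
theorem IsMulX.shift {u q : L2} (h : IsMulX u q) (s : ℝ) :
    IsMulX (shift s u) (shift s q - (s : ℂ) • shift s u) := by
  unfold IsMulX
  filter_upwards [Lp.coeFn_sub (QuantumRabi.shift s q) ((s : ℂ) • QuantumRabi.shift s u),
    Lp.coeFn_smul (s : ℂ) (QuantumRabi.shift s u), shift_coeFn s q, shift_coeFn s u,
    ae_comp_add h s] with x h1 h2 h3 h4 h5
  rw [h1, Pi.sub_apply, h2, Pi.smul_apply, h3, h4, h5, smul_eq_mul]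
  push_cast
  ring

theorem IsMulX.smul {u q : L2} (h : IsMulX u q) (c : ℂ) : IsMulX (c • u) (c • q) := by
  unfold IsMulX
  filter_upwards [Lp.coeFn_smul c u, Lp.coeFn_smul c q, h] with x h1 h2 h3
  rw [h1, h2, Pi.smul_apply, Pi.smul_apply, h3, smul_eq_mul, smul_eq_mul]
  ring

theorem IsMulX.inner_comm {u q u' q' : L2} (h : IsMulX u q) (h' : IsMulX u' q') :
    ⟪u, q'⟫_ℂ = ⟪q, u'⟫_ℂ := by
  rw [L2.inner_def, L2.inner_def]
  refine integral_congr_ae ?_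
  filter_upwards [h, h'] with x h1 h2
  rw [h1, h2]
  simp
  ring

/-- A component of a state of finite energy: an `L²` function `u` with `u'` and `x u` in `L²`. -/
structure Comp where
  /-- the function -/
  u : L2
  /-- its derivative -/
  p : L2
  /-- the product with the position variable -/
  q : L2
  gen : HasGen u p
  mul : IsMulX u q

/-! ### Translates of a component and the oscillator bound -/

namespace Comp

/-- The first moment `∫ x |u|²`. -/
noncomputable def moment (c : Comp) : ℝ := (⟪c.u, c.q⟫_ℂ).re

/-- The translate of a component. -/
noncomputable def shift (c : Comp) (s : ℝ) : Comp where
  u := QuantumRabi.shift s c.u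
  p := QuantumRabi.shift s c.p
  q := QuantumRabi.shift s c.q - (s : ℂ) • QuantumRabi.shift s c.u
  gen := c.gen.shift s
  mul := c.mul.shift s

/-- A scalar multiple of a component. -/
noncomputable def smul (z : ℂ) (c : Comp) : Comp where
  u := z • c.u
  p := z • c.p
  q := z • c.q
  gen := c.gen.smul z
  mul := c.mul.smul z

theorem re_inner_self (f : L2) : (⟪f, f⟫_ℂ).re = ‖f‖ ^ 2 := by
  have := inner_self_eq_norm_sq (𝕜 := ℂ) f
  simpa using this

theorem norm_u_shift (c : Comp) (s : ℝ) : ‖(c.shift s).u‖ = ‖c.u‖ := LinearIsometry.norm_map _ _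

theorem norm_p_shift (c : Comp) (s : ℝ) : ‖(c.shift s).p‖ = ‖c.p‖ := LinearIsometry.norm_map _ _

theorem moment_shift (c : Comp) (s : ℝ) :
    (c.shift s).moment = c.moment - s * ‖c.u‖ ^ 2 := by
  simp only [moment, shift]
  rw [inner_sub_right, inner_smul_right, LinearIsometry.inner_map_map,
    LinearIsometry.inner_map_map, Complex.sub_re, Complex.re_ofReal_mul, re_inner_self]

theorem norm_q_shift_sq (c : Comp) (s : ℝ) :
    ‖(c.shift s).q‖ ^ 2 = ‖c.q‖ ^ 2 - 2 * s * c.moment + s ^ 2 * ‖c.u‖ ^ 2 := by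
  have e : (⟪c.q, c.u⟫_ℂ).re = (⟪c.u, c.q⟫_ℂ).re := by
    rw [← inner_conj_symm, Complex.conj_re]
  simp only [shift, moment]
  rw [norm_sub_sq (𝕜 := ℂ), norm_smul, LinearIsometry.norm_map, LinearIsometry.norm_map,
    inner_smul_right, LinearIsometry.inner_map_map, RCLike.re_eq_complex_re,
    Complex.re_ofReal_mul, e]
  simp [mul_pow]
  ring

/-- Formally `∫ x (|u|²)' = -∫ |u|²`: differentiate `moment_shift` at `s = 0`. Since `q` need not be
differentiable, symmetry of multiplication by `x` moves its increment onto `u`. -/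
theorem two_mul_re_inner_p_q (c : Comp) : 2 * (⟪c.p, c.q⟫_ℂ).re = -‖c.u‖ ^ 2 := by
  have hslope : Tendsto (fun s : ℝ => ((s⁻¹ : ℝ) : ℂ) • (QuantumRabi.shift s c.u - c.u))
      (𝓝[≠] 0) (𝓝 c.p) := by
    refine (hasDerivAt_iff_tendsto_slope_zero.1 c.gen).congr fun s => ?_
    rw [zero_add, shift_zero]
    exact (Complex.coe_smul _ _).symm
  have hq : Tendsto (fun s : ℝ => (c.shift s).q) (𝓝[≠] 0) (𝓝 c.q) := by
    have h1 : Continuous fun s : ℝ => (c.shift s).q :=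
      (continuous_shift c.q).sub (Complex.continuous_ofReal.smul (continuous_shift c.u))
    have h2 := h1.tendsto 0
    simp only [shift, Complex.ofReal_zero, zero_smul, sub_zero, shift_zero] at h2
    exact h2.mono_left nhdsWithin_le_nhds
  have h3 := (hslope.inner (𝕜 := ℂ) hq).add ((tendsto_const_nhds (x := c.q)).inner (𝕜 := ℂ) hslope)
  have h4 := (Complex.continuous_re.tendsto _).comp h3
  have h5 : Tendsto (fun _ : ℝ => -‖c.u‖ ^ 2) (𝓝[≠] (0 : ℝ))
      (𝓝 (⟪c.p, c.q⟫_ℂ + ⟪c.q, c.p⟫_ℂ).re) := by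
    refine h4.congr' ?_
    filter_upwards [self_mem_nhdsWithin] with s hs
    have hm := c.moment_shift s
    have hc : ⟪c.q, QuantumRabi.shift s c.u⟫_ℂ = ⟪c.u, (c.shift s).q⟫_ℂ :=
      (c.mul.inner_comm (c.shift s).mul).symm
    have hs' : s ≠ 0 := hs
    simp only [Function.comp]
    rw [inner_smul_left, inner_smul_right, inner_sub_left, inner_sub_right, hc]
    simp only [Complex.conj_ofReal, ← mul_add]
    have e : ⟪QuantumRabi.shift s c.u, (c.shift s).q⟫_ℂ - ⟪c.u, (c.shift s).q⟫_ℂ +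
        (⟪c.u, (c.shift s).q⟫_ℂ - ⟪c.q, c.u⟫_ℂ) =
        ⟪(c.shift s).u, (c.shift s).q⟫_ℂ - ⟪c.q, c.u⟫_ℂ := by
      simp [shift]
    have e2 : (⟪c.q, c.u⟫_ℂ).re = c.moment := by
      rw [← inner_conj_symm, Complex.conj_re, moment]
    rw [e, Complex.re_ofReal_mul, Complex.sub_re, e2]
    change s⁻¹ * ((c.shift s).moment - c.moment) = _
    rw [hm]
    field_simp
    ring
  have h6 := tendsto_nhds_unique h5 tendsto_const_nhds
  rw [Complex.add_re, ← inner_conj_symm c.q c.p, Complex.conj_re] at h6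
  linarith

/-- Factorization through the annihilation operator: the cross term of the square is `-ω ‖u‖²` by
`two_mul_re_inner_p_q`. -/
theorem oscillator_eq (ω : ℝ) (c : Comp) :
    ‖c.p‖ ^ 2 + ω ^ 2 * ‖c.q‖ ^ 2 = ω * ‖c.u‖ ^ 2 + ‖c.p + (ω : ℂ) • c.q‖ ^ 2 := by
  have h := c.two_mul_re_inner_p_q
  rw [norm_add_sq (𝕜 := ℂ), inner_smul_right, norm_smul]
  simp [mul_pow]
  linear_combination (-ω) * h

theorem oscillator_le (ω : ℝ) (c : Comp) :
    ω * ‖c.u‖ ^ 2 ≤ ‖c.p‖ ^ 2 + ω ^ 2 * ‖c.q‖ ^ 2 := by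
  rw [oscillator_eq]
  linarith [sq_nonneg ‖c.p + (ω : ℂ) • c.q‖]

/-- The energy bound for the oscillator displaced by `a`. -/
theorem oscillator_shift_le (ω a : ℝ) (c : Comp) :
    ω * ‖c.u‖ ^ 2 ≤
      ‖c.p‖ ^ 2 + ω ^ 2 * (‖c.q‖ ^ 2 - 2 * a * c.moment + a ^ 2 * ‖c.u‖ ^ 2) := by
  have := oscillator_le ω (c.shift a)
  rwa [norm_u_shift, norm_p_shift, norm_q_shift_sq] at this

/-- Saturating the bound at the origin while obeying it for every displaced oscillator makes `a²
‖u‖² - 2 a m` nonnegative for all `a`, so its linear coefficient vanishes. -/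
theorem moment_eq_zero_of_ground {ω : ℝ} (hω : 0 < ω) {c : Comp}
    (h : ‖c.p‖ ^ 2 + ω ^ 2 * ‖c.q‖ ^ 2 = ω * ‖c.u‖ ^ 2) : c.moment = 0 := by
  have key : ∀ a : ℝ, 0 ≤ ω ^ 2 * (a ^ 2 * ‖c.u‖ ^ 2 - 2 * a * c.moment) := by
    intro a
    have := oscillator_shift_le ω a c
    nlinarith
  have hp : 0 < ω ^ 2 := by positivity
  have key' : ∀ a : ℝ, 0 ≤ a ^ 2 * ‖c.u‖ ^ 2 - 2 * a * c.moment := fun a =>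
    nonneg_of_mul_nonneg_right (key a) hp
  set N := ‖c.u‖ ^ 2
  have hN : 0 ≤ N := by positivity
  -- Near the minimizing displacement `m / N`; the `+ 1` covers `u = 0`.
  have h1 := key' (c.moment / (N + 1))
  have h2 : (c.moment / (N + 1)) ^ 2 * N - 2 * (c.moment / (N + 1)) * c.moment =
      -(c.moment ^ 2 * (N + 2) / (N + 1) ^ 2) := by
    field_simp
    ring
  rw [h2] at h1
  have h3 : c.moment ^ 2 * (N + 2) / (N + 1) ^ 2 ≤ 0 := by linarith
  by_contra h4
  have : 0 < c.moment ^ 2 * (N + 2) / (N + 1) ^ 2 := by positivity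
  linarith

end Comp

/-! ### The oscillator ground state -/

theorem isWeakDeriv_ofReal {f f' : ℝ → ℝ} (hd : ∀ x, HasDerivAt f (f' x) x)
    (hc : Continuous f') :
    IsWeakDeriv (fun x => (f x : ℂ)) (fun x => (f' x : ℂ)) := by
  have hcf : Continuous f := continuous_iff_continuousAt.2 fun x => (hd x).continuousAt
  refine ⟨(Complex.continuous_ofReal.comp hcf).locallyIntegrable,
    (Complex.continuous_ofReal.comp hc).locallyIntegrable, fun η h1 h2 => ?_⟩
  have hη : ∀ x, HasDerivAt η (deriv η x) x := fun x =>
    ((h1.differentiable (by simp)) x).hasDerivAt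
  have hcη : Continuous (deriv η) := h1.continuous_deriv (by simp)
  have h := integral_mul_deriv_eq_deriv_mul_of_integrable (u := η) (v := f)
    (u' := deriv η) (v' := f') (fun x _ => hη x) (fun x _ => hd x)
    ((h1.continuous.mul hc).integrable_of_hasCompactSupport h2.mul_right)
    ((hcη.mul hcf).integrable_of_hasCompactSupport h2.deriv.mul_right)
    ((h1.continuous.mul hcf).integrable_of_hasCompactSupport h2.mul_right)
  have e1 : ∫ x, deriv η x • (f x : ℂ) = ((∫ x, deriv η x * f x : ℝ) : ℂ) := by
    rw [← integral_complex_ofReal]; simp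
  have e2 : ∫ x, η x • (f' x : ℂ) = ((∫ x, η x * f' x : ℝ) : ℂ) := by
    rw [← integral_complex_ofReal]; simp
  rw [e1, e2, h]
  simp

theorem IsWeakDeriv.congr {u v u' v' : ℝ → ℂ} (h : IsWeakDeriv u u') (hu : u =ᵐ[volume] v)
    (hv : u' =ᵐ[volume] v') : IsWeakDeriv v v' := by
  refine ⟨h.1.congr hu, h.2.1.congr hv, fun η h1 h2 => ?_⟩
  have e := h.2.2 η h1 h2
  have e1 : ∫ x, deriv η x • v x = ∫ x, deriv η x • u x := by
    refine integral_congr_ae ?_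
    filter_upwards [hu] with x hx
    rw [hx]
  have e2 : ∫ x, η x • v' x = ∫ x, η x • u' x := by
    refine integral_congr_ae ?_
    filter_upwards [hv] with x hx
    rw [hx]
  rw [e1, e2, e]

/-- For the Gaussian, `f' = -ω x f`, so the square in `oscillator_eq` is zero. After normalization
the energy is `ω`, without evaluating any Gaussian integral. -/
theorem exists_ground {ω : ℝ} (hω : 0 < ω) :
    ∃ c : Comp, ‖c.u‖ = 1 ∧ ‖c.p‖ ^ 2 + ω ^ 2 * ‖c.q‖ ^ 2 = ω := by
  let f : ℝ → ℝ := fun x => Real.exp (-(ω / 2) * x ^ 2)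
  have hf : ∀ x, HasDerivAt f (-ω * (x * f x)) x := by
    intro x
    have h1 : HasDerivAt (fun x : ℝ => -(ω / 2) * x ^ 2) (-(ω / 2) * (2 * x)) x := by
      simpa using (hasDerivAt_pow 2 x).const_mul (-(ω / 2))
    convert h1.exp using 1
    simp only [f]
    ring
  have hcf : Continuous f := by fun_prop
  have hsq : ∀ x, f x ^ 2 = Real.exp (-ω * x ^ 2) := by
    intro x
    simp only [f]
    rw [← Real.exp_nat_mul]
    congr 1
    push_cast
    ring
  have hfL : MemLp (fun x => (f x : ℂ)) 2 (volume : Measure ℝ) := by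
    rw [memLp_two_iff_integrable_sq_norm (by fun_prop)]
    simpa [hsq] using integrable_exp_neg_mul_sq hω
  have hqL : MemLp (fun x => ((x * f x : ℝ) : ℂ)) 2 (volume : Measure ℝ) := by
    rw [memLp_two_iff_integrable_sq_norm (by fun_prop)]
    have := integrable_rpow_mul_exp_neg_mul_sq hω (s := 2) (by norm_num)
    refine this.congr (Eventually.of_forall fun x => ?_)
    simp only [Complex.norm_real, Real.norm_eq_abs, sq_abs, mul_pow, hsq]
    norm_num
  let u₀ : L2 := hfL.toLp _
  let q₀ : L2 := hqL.toLp _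
  have hgen : HasGen u₀ (-(ω : ℂ) • q₀) := by
    apply IsWeakDeriv.hasGen
    refine (isWeakDeriv_ofReal hf (by fun_prop)).congr hfL.coeFn_toLp.symm ?_
    filter_upwards [Lp.coeFn_smul (-(ω : ℂ)) q₀, hqL.coeFn_toLp] with x h1 h2
    rw [h1, Pi.smul_apply, h2]
    simp
  have hmul : IsMulX u₀ q₀ := by
    unfold IsMulX
    filter_upwards [hfL.coeFn_toLp, hqL.coeFn_toLp] with x h1 h2
    rw [h1, h2]
    simp
  let c : Comp := ⟨u₀, -(ω : ℂ) • q₀, q₀, hgen, hmul⟩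
  have hne : ‖u₀‖ ≠ 0 := by
    intro h0
    have h1 : u₀ =ᵐ[volume] 0 := by
      rw [norm_eq_zero.1 h0]
      exact Lp.coeFn_zero _ _ _
    have h2 : ∀ᵐ _ : ℝ, False := by
      filter_upwards [h1, hfL.coeFn_toLp] with x h3 h4
      rw [h4] at h3
      exact (Real.exp_pos (-(ω / 2) * x ^ 2)).ne' (Complex.ofReal_eq_zero.1 h3)
    obtain ⟨x, hx⟩ := h2.exists
    exact hx
  refine ⟨c.smul ((‖u₀‖⁻¹ : ℝ) : ℂ), ?_, ?_⟩
  · simp only [Comp.smul, c, norm_smul, Complex.norm_real, Real.norm_eq_abs]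
    rw [abs_of_nonneg (by positivity), inv_mul_cancel₀ hne]
  · rw [Comp.oscillator_eq]
    have e1 : ‖(c.smul ((‖u₀‖⁻¹ : ℝ) : ℂ)).u‖ = 1 := by
      simp only [Comp.smul, c, norm_smul, Complex.norm_real, Real.norm_eq_abs]
      rw [abs_of_nonneg (by positivity), inv_mul_cancel₀ hne]
    have e2 : (c.smul ((‖u₀‖⁻¹ : ℝ) : ℂ)).p + (ω : ℂ) • (c.smul ((‖u₀‖⁻¹ : ℝ) : ℂ)).q = 0 := by
      simp only [Comp.smul, c]
      module
    rw [e1, e2]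
    simp

/-! ### Absolute values -/

theorem memLp_abs (f : L2) : MemLp (fun x => ((‖f x‖ : ℝ) : ℂ)) 2 (volume : Measure ℝ) :=
  (Lp.memLp f).norm.ofReal

/-- The absolute value of an `L²` function. -/
noncomputable def absL2 (f : L2) : L2 := (memLp_abs f).toLp _

theorem absL2_coeFn (f : L2) : absL2 f =ᵐ[volume] fun x => ((‖f x‖ : ℝ) : ℂ) :=
  (memLp_abs f).coeFn_toLp

theorem shift_absL2 (s : ℝ) (f : L2) : shift s (absL2 f) = absL2 (shift s f) := by
  refine Lp.ext ?_
  filter_upwards [shift_coeFn s (absL2 f), absL2_coeFn (shift s f), shift_coeFn s f,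
    ae_comp_add (absL2_coeFn f) s] with x h1 h2 h3 h4
  rw [h1, h2, h3, h4]

theorem norm_absL2_sub_le (f g : L2) : ‖absL2 f - absL2 g‖ ≤ ‖f - g‖ := by
  refine Lp.norm_le_norm_of_ae_le ?_
  filter_upwards [Lp.coeFn_sub (absL2 f) (absL2 g), Lp.coeFn_sub f g, absL2_coeFn f,
    absL2_coeFn g] with x h1 h2 h3 h4
  rw [h1, h2, Pi.sub_apply, Pi.sub_apply, h3, h4, ← Complex.ofReal_sub, Complex.norm_real]
  exact abs_norm_sub_norm_le _ _

theorem norm_eq_of_ae_norm_eq {f g : L2} (h : ∀ᵐ x, ‖f x‖ = ‖g x‖) : ‖f‖ = ‖g‖ :=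
  le_antisymm (Lp.norm_le_norm_of_ae_le (h.mono fun _ hx => hx.le))
    (Lp.norm_le_norm_of_ae_le (h.mono fun _ hx => hx.ge))

theorem norm_absL2 (f : L2) : ‖absL2 f‖ = ‖f‖ := by
  refine norm_eq_of_ae_norm_eq ?_
  filter_upwards [absL2_coeFn f] with x h
  rw [h]
  simp

theorem re_inner_le_absL2 (f g : L2) : (⟪f, g⟫_ℂ).re ≤ (⟪absL2 f, absL2 g⟫_ℂ).re := by
  have h := L2.integrable_inner (𝕜 := ℂ) f g
  have h' := L2.integrable_inner (𝕜 := ℂ) (absL2 f) (absL2 g)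
  rw [L2.inner_def, L2.inner_def]
  have e1 : (∫ x, ⟪f x, g x⟫_ℂ).re = ∫ x, (⟪f x, g x⟫_ℂ).re := (integral_re h).symm
  have e2 : (∫ x, ⟪absL2 f x, absL2 g x⟫_ℂ).re = ∫ x, (⟪absL2 f x, absL2 g x⟫_ℂ).re :=
    (integral_re h').symm
  rw [e1, e2]
  refine integral_mono_ae h.re h'.re ?_
  filter_upwards [absL2_coeFn f, absL2_coeFn g] with x h1 h2
  simp only [h1, h2]
  refine (Complex.re_le_norm _).trans ((norm_inner_le_norm _ _).trans (le_of_eq ?_))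
  simp [mul_comm]

/-- The absolute value commutes with translations and is a contraction of `L²`, so the Lipschitz
constant of the orbit, and with it the kinetic energy, does not grow. The remaining quantities see
only `|u|`. -/
theorem Comp.exists_abs (c : Comp) : ∃ c' : Comp, c'.u = absL2 c.u ∧ ‖c'.u‖ = ‖c.u‖ ∧
    ‖c'.p‖ ≤ ‖c.p‖ ∧ ‖c'.q‖ = ‖c.q‖ ∧ c'.moment = c.moment := by
  have hL : ∀ s, ‖QuantumRabi.shift s (absL2 c.u) - absL2 c.u‖ ≤ |s| * ‖c.p‖ := by
    intro s
    rw [shift_absL2]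
    exact (norm_absL2_sub_le _ _).trans (c.gen.norm_shift_sub_le s)
  obtain ⟨p, hp, hpn⟩ := exists_hasGen_of_lipschitz hL
  have hq : MemLp (fun x : ℝ => (x : ℂ) * absL2 c.u x) 2 (volume : Measure ℝ) := by
    refine (Lp.memLp c.q).congr_norm ?_ ?_
    · exact (Complex.continuous_ofReal.aestronglyMeasurable).mul (Lp.aestronglyMeasurable _)
    · filter_upwards [c.mul, absL2_coeFn c.u] with x h1 h2
      rw [h1, h2]
      simp
  have hmul : IsMulX (absL2 c.u) (hq.toLp _) := hq.coeFn_toLp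
  refine ⟨⟨absL2 c.u, p, hq.toLp _, hp, hmul⟩, rfl, norm_absL2 _, hpn, ?_, ?_⟩
  · refine norm_eq_of_ae_norm_eq ?_
    filter_upwards [c.mul, absL2_coeFn c.u, hmul] with x h1 h2 h3
    rw [h3, h1, h2]
    simp
  · simp only [Comp.moment]
    rw [L2.inner_def, L2.inner_def]
    congr 1
    refine integral_congr_ae ?_
    filter_upwards [c.mul, absL2_coeFn c.u, hmul] with x h1 h2 h3
    rw [h3, h1, h2]
    simp only [RCLike.inner_apply, Complex.conj_ofReal, mul_assoc, Complex.mul_conj,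
      Complex.normSq_eq_norm_sq]
    push_cast
    ring

/-! ### Compactness -/

theorem norm_sq_eq_integral (f : L2) : ‖f‖ ^ 2 = ∫ x, ‖f x‖ ^ 2 := by
  rw [← Comp.re_inner_self, L2.inner_def]
  have h := L2.integrable_inner (𝕜 := ℂ) f f
  refine (integral_re h).symm.trans ?_
  refine integral_congr_ae (Eventually.of_forall fun x => ?_)
  exact inner_self_eq_norm_sq (𝕜 := ℂ) (f x)

theorem integrable_norm_sq (f : L2) : Integrable (fun x => ‖f x‖ ^ 2) :=
  (memLp_two_iff_integrable_sq_norm (Lp.aestronglyMeasurable f)).1 (Lp.memLp f)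

theorem L2.intervalIntegrable (f : L2) (a b : ℝ) : IntervalIntegrable f volume a b :=
  ((L2.locallyIntegrable f).integrableOn_isCompact isCompact_uIcc).intervalIntegrable

/-- Identifies the `L²`-valued average of translates with a sliding-window integral, by testing and
Fubini. The window integral has pointwise values, which weak convergence controls. -/
theorem integral_shift_coeFn (f : L2) {h : ℝ} (hh : 0 ≤ h) :
    (∫ s in (0 : ℝ)..h, shift s f : L2) =ᵐ[volume] fun x => ∫ y in x..(x + h), f y := by
  have hcont : Continuous fun x => ∫ y in x..(x + h), f y := by
    have h1 : Continuous fun x => ∫ y in (0 : ℝ)..x, f y :=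
      intervalIntegral.continuous_primitive (L2.intervalIntegrable f) 0
    have h2 : (fun x => ∫ y in x..(x + h), f y) =
        fun x => (∫ y in (0 : ℝ)..(x + h), f y) - ∫ y in (0 : ℝ)..x, f y := by
      funext x
      exact (intervalIntegral.integral_interval_sub_left (L2.intervalIntegrable f _ _)
        (L2.intervalIntegrable f _ _)).symm
    rw [h2]
    exact (h1.comp (continuous_id.add continuous_const)).sub h1
  refine ae_eq_of_integral_contDiff_smul_eq (L2.locallyIntegrable _) hcont.locallyIntegrable ?_
  intro η h1 h2
  let T : Test := ⟨η, h1, h2⟩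
  have e1 := Test.inner_toL2 T (∫ s in (0 : ℝ)..h, shift s f)
  have e2 := (innerSL ℂ T.toL2).intervalIntegral_comp_comm
    ((continuous_shift f).intervalIntegrable (μ := volume) 0 h)
  simp only [innerSL_apply_apply] at e2
  change _ = ∫ x, η x • _ at e1
  rw [← e1, ← e2]
  have hmeas : StronglyMeasurable fun z : ℝ × ℝ => η z.2 • f (z.2 + z.1) := by
    have m1 : StronglyMeasurable fun z : ℝ × ℝ => η z.2 :=
      (h1.continuous.comp continuous_snd).stronglyMeasurable
    have m2 : StronglyMeasurable fun z : ℝ × ℝ => f (z.2 + z.1) :=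
      (Lp.stronglyMeasurable f).comp_measurable (by fun_prop)
    exact m1.smul m2
  have hsl : ∀ s, Integrable fun x => η x • f (x + s) := by
    intro s
    have h3 := L2.integrable_inner (𝕜 := ℂ) T.toL2 (shift s f)
    refine h3.congr ?_
    filter_upwards [T.memLp.coeFn_toLp, shift_coeFn s f] with x h4 h5
    rw [h5, Test.toL2, h4]
    simp [mul_comm, T]
  -- Replacing both factors by absolute values turns the `L¹` norm of the product into an inner
  -- product, bounded by Cauchy–Schwarz uniformly in `s`.
  have hnorm : ∀ s, ∫ x, ‖η x • f (x + s)‖ ≤ ‖T.toL2‖ * ‖f‖ := by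
    intro s
    have h4 : (⟪absL2 T.toL2, absL2 (shift s f)⟫_ℂ).re ≤ ‖T.toL2‖ * ‖f‖ := by
      refine (Complex.re_le_norm _).trans ((norm_inner_le_norm _ _).trans ?_)
      rw [norm_absL2, norm_absL2, LinearIsometry.norm_map]
    refine le_trans (le_of_eq ?_) h4
    have h5 := L2.integrable_inner (𝕜 := ℂ) (absL2 T.toL2) (absL2 (shift s f))
    rw [L2.inner_def]
    refine Eq.trans ?_ (integral_re h5)
    refine integral_congr_ae ?_
    filter_upwards [T.memLp.coeFn_toLp, shift_coeFn s f, absL2_coeFn T.toL2,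
      absL2_coeFn (shift s f)] with x h6 h7 h8 h9
    rw [h8, h9, h7, Test.toL2, h6]
    simp [mul_comm, T]
  have hint : Integrable (Function.uncurry fun s x => η x • f (x + s))
      ((volume.restrict (Ioc 0 h)).prod volume) := by
    refine (integrable_prod_iff hmeas.aestronglyMeasurable).2 ?_
    refine ⟨Eventually.of_forall fun s => hsl s, ?_⟩
    refine Integrable.of_bound (C := ‖T.toL2‖ * ‖f‖) ?_ (Eventually.of_forall fun s => ?_)
    · exact (hmeas.norm.integral_prod_right).aestronglyMeasurable
    · rw [Real.norm_of_nonneg (integral_nonneg fun x => norm_nonneg _)]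
      exact hnorm s
  have e3 : ∀ s, ⟪T.toL2, shift s f⟫_ℂ = ∫ x, η x • f (x + s) := by
    intro s
    rw [Test.inner_toL2]
    refine integral_congr_ae ?_
    filter_upwards [shift_coeFn s f] with x h5
    rw [h5]
  simp only [e3]
  rw [intervalIntegral.integral_of_le hh, integral_integral_swap hint]
  refine integral_congr_ae (Eventually.of_forall fun x => ?_)
  simp only
  rw [integral_smul, ← intervalIntegral.integral_of_le hh,
    intervalIntegral.integral_comp_add_left (fun y => f y), add_zero]

theorem norm_integral_shift_sub_le {f : L2} {K h : ℝ} (hh : 0 ≤ h)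
    (hf : ∀ s, ‖shift s f - f‖ ≤ |s| * K) (hK : 0 ≤ K) :
    ‖(∫ s in (0 : ℝ)..h, shift s f) - (h : ℂ) • f‖ ≤ h * K * h := by
  have e : (h : ℂ) • f = ∫ s in (0 : ℝ)..h, f := by
    rw [intervalIntegral.integral_const, sub_zero]
    exact Complex.coe_smul _ _
  rw [e, ← intervalIntegral.integral_sub ((continuous_shift f).intervalIntegrable _ _)
    (by simp)]
  have := intervalIntegral.norm_integral_le_of_norm_le_const (a := 0) (b := h)
    (f := fun s => shift s f - f) (C := h * K) (fun s hs => ?_)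
  · simpa [abs_of_nonneg hh] using this
  · rw [uIoc_of_le hh] at hs
    refine (hf s).trans ?_
    rw [abs_of_nonneg hs.1.le]
    exact mul_le_mul_of_nonneg_right hs.2 hK

theorem interval_integral_eq_inner (f : L2) {x h : ℝ} (hh : 0 ≤ h) :
    ∫ y in x..(x + h), f y =
      ⟪indicatorConstLp 2 (μ := volume) (measurableSet_Ioc (a := x) (b := x + h))
        (by simp) (1 : ℂ), f⟫_ℂ := by
  rw [L2.inner_indicatorConstLp_one, intervalIntegral.integral_of_le (by linarith)]

theorem norm_interval_integral_le (f : L2) {x h : ℝ} (hh : 0 ≤ h) :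
    ‖∫ y in x..(x + h), f y‖ ≤ h ^ (1 / 2 : ℝ) * ‖f‖ := by
  rw [interval_integral_eq_inner f hh]
  refine (norm_inner_le_norm _ _).trans ?_
  rw [norm_indicatorConstLp (by simp) (by simp)]
  simp [hh]

/-- Outside `[-R, R]`, `|w| ≤ |q| / R`. Inside, write `h w = A - (A - h w)` with `A` the window
integral and use `(x + y)² ≤ 2x² + 2y²`. -/
theorem norm_sq_le_of_mulX {w q : L2} (hq : IsMulX w q) {R h : ℝ} (hR : 0 < R) (hh : 0 < h) :
    ‖w‖ ^ 2 ≤ (R ^ 2)⁻¹ * ‖q‖ ^ 2 +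
      2 * (h ^ 2)⁻¹ * (∫ x in Icc (-R) R, ‖∫ y in x..(x + h), w y‖ ^ 2) +
      2 * (h ^ 2)⁻¹ * ‖(∫ s in (0 : ℝ)..h, shift s w) - (h : ℂ) • w‖ ^ 2 := by
  set A : L2 := ∫ s in (0 : ℝ)..h, shift s w with hA
  have hAe := integral_shift_coeFn w hh.le
  have e1 : ∫ x in Icc (-R) R, ‖∫ y in x..(x + h), w y‖ ^ 2 =
      ∫ x, (Icc (-R) R).indicator (fun x => ‖A x‖ ^ 2) x := by
    rw [integral_indicator measurableSet_Icc]
    refine integral_congr_ae (ae_restrict_of_ae ?_)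
    filter_upwards [hAe] with x hx
    rw [hA, hx]
  rw [e1, norm_sq_eq_integral, norm_sq_eq_integral q, norm_sq_eq_integral (A - _),
    ← integral_const_mul, ← integral_const_mul, ← integral_const_mul]
  have i1 : Integrable fun x => (R ^ 2)⁻¹ * ‖q x‖ ^ 2 := (integrable_norm_sq q).const_mul _
  have i2 : Integrable fun x => 2 * (h ^ 2)⁻¹ * (Icc (-R) R).indicator (fun x => ‖A x‖ ^ 2) x :=
    ((integrable_norm_sq A).indicator measurableSet_Icc).const_mul _
  have i3 : Integrable fun x => 2 * (h ^ 2)⁻¹ * ‖(A - (h : ℂ) • w) x‖ ^ 2 :=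
    (integrable_norm_sq _).const_mul _
  rw [← integral_add i1 i2]
  refine le_trans ?_ (integral_add (i1.add i2) i3).le
  refine integral_mono_ae (integrable_norm_sq w) ((i1.add i2).add i3) ?_
  filter_upwards [hq, Lp.coeFn_sub A ((h : ℂ) • w), Lp.coeFn_smul (h : ℂ) w] with x h1 h2 h3
  simp only [Pi.add_apply]
  by_cases hx : x ∈ Icc (-R) R
  · rw [indicator_of_mem hx, h2, Pi.sub_apply, h3, Pi.smul_apply, smul_eq_mul]
    have h4 : h * ‖w x‖ ≤ ‖A x‖ + ‖A x - h * w x‖ := by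
      have := norm_sub_le (A x) (A x - h * w x)
      rw [sub_sub_cancel, norm_mul, Complex.norm_real, Real.norm_of_nonneg hh.le] at this
      exact this
    have h5 : h ^ 2 * ‖w x‖ ^ 2 ≤ 2 * ‖A x‖ ^ 2 + 2 * ‖A x - h * w x‖ ^ 2 := by
      rw [← mul_pow]
      refine (pow_le_pow_left₀ (by positivity) h4 2).trans ?_
      nlinarith [sq_nonneg (‖A x‖ - ‖A x - h * w x‖)]
    have h6 : ‖w x‖ ^ 2 ≤ (h ^ 2)⁻¹ * (2 * ‖A x‖ ^ 2 + 2 * ‖A x - h * w x‖ ^ 2) := by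
      rw [le_inv_mul_iff₀ (by positivity)]
      exact h5
    have h7 : 0 ≤ (R ^ 2)⁻¹ * ‖q x‖ ^ 2 := by positivity
    linarith
  · rw [indicator_of_notMem hx, h1, norm_mul, Complex.norm_real]
    have h4 : R ^ 2 ≤ ‖x‖ ^ 2 := by
      rw [Real.norm_eq_abs]
      refine pow_le_pow_left₀ hR.le ?_ 2
      by_contra hlt
      exact hx (abs_le.1 (not_le.1 hlt).le)
    have h5 : ‖w x‖ ^ 2 ≤ (R ^ 2)⁻¹ * (‖x‖ * ‖w x‖) ^ 2 := by
      rw [le_inv_mul_iff₀ (by positivity), mul_pow]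
      exact mul_le_mul_of_nonneg_right h4 (by positivity)
    have h7 : 0 ≤ 2 * (h ^ 2)⁻¹ * ‖(A - (h : ℂ) • w) x‖ ^ 2 := by positivity
    linarith

/-- A Rellich-type theorem in the manner of Kolmogorov–Riesz: the bound on `q` controls the tails
and the Lipschitz bound the averaging error, both uniformly in `n`. For fixed `R` and `h` the window
integrals tend to zero by weak and dominated convergence. So `R` and `h` are chosen before `n`. -/
theorem tendsto_zero_of_weak {w q : ℕ → L2} {B K C : ℝ} (hB : ∀ n, ‖w n‖ ≤ B)
    (hK : ∀ n s, ‖shift s (w n) - w n‖ ≤ |s| * K) (hK0 : 0 ≤ K)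
    (hq : ∀ n, IsMulX (w n) (q n)) (hC : ∀ n, ‖q n‖ ≤ C)
    (hw : ∀ y, Tendsto (fun n => ⟪y, w n⟫_ℂ) atTop (𝓝 0)) : Tendsto w atTop (𝓝 0) := by
  have hB0 : 0 ≤ B := (norm_nonneg _).trans (hB 0)
  have hI : ∀ R h : ℝ, 0 < h → Tendsto (fun n => ∫ x in Icc (-R) R, ‖∫ y in x..(x + h), w n y‖ ^ 2)
      atTop (𝓝 0) := by
    intro R h hh
    have h0 : (0 : ℝ) = ∫ x in Icc (-R) R, (0 : ℝ) := by simp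
    rw [h0]
    refine tendsto_integral_of_dominated_convergence (fun _ => (h ^ (1 / 2 : ℝ) * B) ^ 2) ?_ ?_ ?_ ?_
    · intro n
      have h1 := (Lp.aestronglyMeasurable (∫ s in (0 : ℝ)..h, shift s (w n))).congr
        (integral_shift_coeFn (w n) hh.le)
      exact (h1.norm.pow 2).restrict
    · exact integrable_const _
    · intro n
      refine Eventually.of_forall fun x => ?_
      rw [norm_pow, norm_norm]
      refine pow_le_pow_left₀ (norm_nonneg _) ((norm_interval_integral_le _ hh.le).trans ?_) 2
      exact mul_le_mul_of_nonneg_left (hB n) (by positivity)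
    · refine Eventually.of_forall fun x => ?_
      have h1 := (hw (indicatorConstLp 2 (μ := volume) (measurableSet_Ioc (a := x) (b := x + h))
        (by simp) (1 : ℂ))).norm.pow 2
      simp only [norm_zero, ne_eq, OfNat.ofNat_ne_zero, not_false_eq_true, zero_pow] at h1
      exact h1.congr fun n => by rw [interval_integral_eq_inner _ hh.le]
  rw [tendsto_zero_iff_norm_tendsto_zero]
  have hsq : Tendsto (fun n => ‖w n‖ ^ 2) atTop (𝓝 0) := by
    rw [Metric.tendsto_atTop]
    intro ε hε
    obtain ⟨R, hR, hR'⟩ : ∃ R : ℝ, 0 < R ∧ (R ^ 2)⁻¹ * C ^ 2 < ε / 3 := by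
      have h1 : Tendsto (fun R : ℝ => (R ^ 2)⁻¹ * C ^ 2) atTop (𝓝 (0 * C ^ 2)) :=
        ((tendsto_inv_atTop_zero.comp (tendsto_pow_atTop two_ne_zero))).mul_const _
      rw [zero_mul] at h1
      exact ((eventually_gt_atTop 0).and (h1.eventually_lt_const (by positivity))).exists
    obtain ⟨h, hh, hh'⟩ : ∃ h : ℝ, 0 < h ∧ 2 * (h * K) ^ 2 < ε / 3 := by
      have h1 : Tendsto (fun h : ℝ => 2 * (h * K) ^ 2) (𝓝[>] 0) (𝓝 (2 * (0 * K) ^ 2)) := by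
        refine Tendsto.mono_left (Continuous.tendsto (by fun_prop) 0) nhdsWithin_le_nhds
      have h2 : 2 * (0 * K) ^ 2 < ε / 3 := by simp; positivity
      exact ((eventually_mem_nhdsWithin).and (h1.eventually_lt_const h2)).exists
    have h2 := (hI R h hh).const_mul (2 * (h ^ 2)⁻¹)
    rw [mul_zero] at h2
    obtain ⟨n₀, hn₀⟩ := eventually_atTop.1 (h2.eventually_lt_const (show 0 < ε / 3 by positivity))
    refine ⟨n₀, fun n hn => ?_⟩
    rw [Real.dist_eq, sub_zero, abs_of_nonneg (by positivity)]
    have h3 := norm_sq_le_of_mulX (hq n) hR hh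
    have h4 : (R ^ 2)⁻¹ * ‖q n‖ ^ 2 ≤ (R ^ 2)⁻¹ * C ^ 2 :=
      mul_le_mul_of_nonneg_left (pow_le_pow_left₀ (norm_nonneg _) (hC n) 2) (by positivity)
    have h5 : 2 * (h ^ 2)⁻¹ * ‖(∫ s in (0 : ℝ)..h, shift s (w n)) - (h : ℂ) • w n‖ ^ 2 ≤
        2 * (h * K) ^ 2 := by
      have h6 := pow_le_pow_left₀ (norm_nonneg _)
        (norm_integral_shift_sub_le hh.le (hK n) hK0) 2
      calc _ ≤ 2 * (h ^ 2)⁻¹ * (h * K * h) ^ 2 := mul_le_mul_of_nonneg_left h6 (by positivity)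
        _ = _ := by field_simp
    have := hn₀ n hn
    linarith
  have h3 := (Real.continuous_sqrt.tendsto 0).comp hsq
  rw [Real.sqrt_zero] at h3
  exact h3.congr fun n => by simp [Real.sqrt_sq]

/-- A test function times `x` is again a test function, so the relation survives weak limits. -/
theorem isMulX_of_weak {u q : ℕ → L2} {a b : L2} (hq : ∀ n, IsMulX (u n) (q n))
    (hu : ∀ y, Tendsto (fun n => ⟪y, u n⟫_ℂ) atTop (𝓝 ⟪y, a⟫_ℂ))
    (hw : ∀ y, Tendsto (fun n => ⟪y, q n⟫_ℂ) atTop (𝓝 ⟪y, b⟫_ℂ)) : IsMulX a b := by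
  unfold IsMulX
  have hl : LocallyIntegrable fun x : ℝ => (x : ℂ) * a x :=
    (L2.locallyIntegrable a).continuous_mul Complex.continuous_ofReal
  refine ae_eq_of_integral_contDiff_smul_eq (L2.locallyIntegrable b) hl ?_
  intro η h1 h2
  let T : Test := ⟨η, h1, h2⟩
  let S : Test := ⟨fun x => x * η x, contDiff_id.mul h1, h2.mul_left⟩
  have e : ∀ v : L2, ∫ x, η x • ((x : ℂ) * v x) = ⟪S.toL2, v⟫_ℂ := by
    intro v
    rw [Test.inner_toL2]
    refine integral_congr_ae (Eventually.of_forall fun x => ?_)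
    simp [S]
    ring
  have e1 : ∫ x, η x • b x = ⟪T.toL2, b⟫_ℂ := (Test.inner_toL2 T b).symm
  rw [e, e1]
  refine tendsto_nhds_unique (hw T.toL2) ((hu S.toL2).congr fun n => ?_)
  rw [← e, Test.inner_toL2]
  refine integral_congr_ae ?_
  filter_upwards [hq n] with x hx
  rw [hx]

theorem norm_shift_sub_le_of_tendsto {u : ℕ → L2} {a : L2} {K : ℝ}
    (hu : Tendsto u atTop (𝓝 a)) {r : ℕ → ℝ} (hr : Tendsto r atTop (𝓝 K))
    (hK : ∀ n s, ‖shift s (u n) - u n‖ ≤ |s| * r n) (s : ℝ) : ‖shift s a - a‖ ≤ |s| * K := by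
  have h1 : Tendsto (fun n => ‖shift s (u n) - u n‖) atTop (𝓝 ‖shift s a - a‖) :=
    ((((shift s).continuous.tendsto a).comp hu).sub hu).norm
  exact le_of_tendsto_of_tendsto h1 (hr.const_mul _) (Eventually.of_forall fun n => hK n s)

theorem norm_shift_sub_le_of_weak {u : ℕ → L2} {a : L2} {K : ℝ}
    (hu : ∀ y, Tendsto (fun n => ⟪y, u n⟫_ℂ) atTop (𝓝 ⟪y, a⟫_ℂ))
    (hK : ∀ n s, ‖shift s (u n) - u n‖ ≤ |s| * K) (s : ℝ) : ‖shift s a - a‖ ≤ |s| * K := by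
  refine norm_le_of_weak_limit (x := fun n => shift s (u n) - u n) (fun y => ?_)
    (fun n => hK n s) tendsto_const_nhds
  have e : ∀ v : L2, ⟪y, shift s v - v⟫_ℂ = ⟪shift (-s) y, v⟫_ℂ - ⟪y, v⟫_ℂ := by
    intro v
    rw [inner_sub_right, ← LinearIsometry.inner_map_map (shift (-s)) y, shift_shift,
      neg_add_cancel, shift_zero]
  simp only [e]
  exact (hu _).sub (hu y)

/-- Strong convergence of `u` and weak convergence of `q` make the moments converge. The norms of
`p` and `q` are only lower semicontinuous, so their limits `k` and `l` are recorded separately. -/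
theorem Comp.exists_limit {c : ℕ → Comp} {B : ℝ} (hu : ∀ n, ‖(c n).u‖ ≤ B)
    (hp : ∀ n, ‖(c n).p‖ ≤ B) (hq : ∀ n, ‖(c n).q‖ ≤ B) :
    ∃ (d : Comp) (φ : ℕ → ℕ) (k l : ℝ), StrictMono φ ∧
      Tendsto (fun n => (c (φ n)).u) atTop (𝓝 d.u) ∧
      Tendsto (fun n => (c (φ n)).moment) atTop (𝓝 d.moment) ∧
      Tendsto (fun n => ‖(c (φ n)).p‖) atTop (𝓝 k) ∧
      Tendsto (fun n => ‖(c (φ n)).q‖) atTop (𝓝 l) ∧ ‖d.p‖ ≤ k ∧ ‖d.q‖ ≤ l := by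
  have hB : 0 ≤ B := (norm_nonneg _).trans (hu 0)
  obtain ⟨k, -, φ₁, hφ₁, hk⟩ := (isCompact_Icc (a := 0) (b := B)).tendsto_subseq
    (x := fun n => ‖(c n).p‖) (fun n => ⟨norm_nonneg _, hp n⟩)
  obtain ⟨l, -, φ₂, hφ₂, hl⟩ := (isCompact_Icc (a := 0) (b := B)).tendsto_subseq
    (x := fun n => ‖(c (φ₁ n)).q‖) (fun n => ⟨norm_nonneg _, hq _⟩)
  obtain ⟨a, φ₃, hφ₃, ha⟩ := exists_weakly_convergent_subseq
    (x := fun n => (c (φ₁ (φ₂ n))).u) (fun n => hu _)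
  obtain ⟨b, φ₄, hφ₄, hb⟩ := exists_weakly_convergent_subseq
    (x := fun n => (c (φ₁ (φ₂ (φ₃ n)))).q) (fun n => hq _)
  let φ : ℕ → ℕ := fun n => φ₁ (φ₂ (φ₃ (φ₄ n)))
  have hφ : StrictMono φ := hφ₁.comp (hφ₂.comp (hφ₃.comp hφ₄))
  have ha' : ∀ y, Tendsto (fun n => ⟪y, (c (φ n)).u⟫_ℂ) atTop (𝓝 ⟪y, a⟫_ℂ) := fun y =>
    (ha y).comp hφ₄.tendsto_atTop
  have hk' : Tendsto (fun n => ‖(c (φ n)).p‖) atTop (𝓝 k) :=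
    hk.comp (hφ₂.comp (hφ₃.comp hφ₄)).tendsto_atTop
  have hl' : Tendsto (fun n => ‖(c (φ n)).q‖) atTop (𝓝 l) :=
    hl.comp (hφ₃.comp hφ₄).tendsto_atTop
  have hab : IsMulX a b := isMulX_of_weak (fun n => (c (φ n)).mul) ha' hb
  have haB : ‖a‖ ≤ B := norm_le_of_weak_limit ha' (fun n => hu _) tendsto_const_nhds
  have hbB : ‖b‖ ≤ B := norm_le_of_weak_limit hb (fun n => hq _) tendsto_const_nhds
  have hsh : ∀ n s, ‖QuantumRabi.shift s (c (φ n)).u - (c (φ n)).u‖ ≤ |s| * B := fun n s =>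
    ((c (φ n)).gen.norm_shift_sub_le s).trans (mul_le_mul_of_nonneg_left (hp _) (abs_nonneg _))
  have hstrong : Tendsto (fun n => (c (φ n)).u - a) atTop (𝓝 0) := by
    refine tendsto_zero_of_weak (q := fun n => (c (φ n)).q - b) (B := B + B) (K := B + B)
      (C := B + B) ?_ ?_ (by linarith) ?_ ?_ ?_
    · exact fun n => (norm_sub_le _ _).trans (add_le_add (hu _) haB)
    · intro n s
      have e : QuantumRabi.shift s ((c (φ n)).u - a) - ((c (φ n)).u - a) =
          (QuantumRabi.shift s (c (φ n)).u - (c (φ n)).u) - (QuantumRabi.shift s a - a) := by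
        rw [map_sub]
        abel
      rw [e, mul_add]
      exact (norm_sub_le _ _).trans (add_le_add (hsh n s) (norm_shift_sub_le_of_weak ha' hsh s))
    · intro n
      unfold IsMulX
      filter_upwards [Lp.coeFn_sub (c (φ n)).q b, Lp.coeFn_sub (c (φ n)).u a, hab,
        (c (φ n)).mul] with x h1 h2 h3 h4
      rw [h1, h2, Pi.sub_apply, Pi.sub_apply, h3, h4, mul_sub]
    · exact fun n => (norm_sub_le _ _).trans (add_le_add (hq _) hbB)
    · intro y
      have := (ha' y).sub_const ⟪y, a⟫_ℂ
      rw [sub_self] at this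
      exact this.congr fun n => (inner_sub_right _ _ _).symm
  have hu' : Tendsto (fun n => (c (φ n)).u) atTop (𝓝 a) := by
    simpa using hstrong.add_const a
  -- The limiting orbit is Lipschitz with constant `k = lim ‖pₙ‖`, which supplies the derivative and
  -- the bound at once.
  obtain ⟨p, hgen, hpk⟩ := exists_hasGen_of_lipschitz
    (norm_shift_sub_le_of_tendsto hu' hk' fun n s => (c (φ n)).gen.norm_shift_sub_le s)
  refine ⟨⟨a, p, b, hgen, hab⟩, φ, k, l, hφ, hu', ?_, hk', hl', hpk,
    norm_le_of_weak_limit hb (fun n => le_rfl) hl'⟩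
  exact (Complex.continuous_re.tendsto _).comp
    (tendsto_inner_of_tendsto_of_weak hu' (fun n => hq _) hb)

/-! ### The variational problem in `L²` -/

/-- The energy of a pair of components, with coupling `μ`. -/
noncomputable def energy (ω t μ : ℝ) (a b : Comp) : ℝ :=
  (‖a.p‖ ^ 2 + ‖b.p‖ ^ 2) / 2 + ω ^ 2 / 2 * (‖a.q‖ ^ 2 + ‖b.q‖ ^ 2) -
    2 * t * (⟪a.u, b.u⟫_ℂ).re + μ * (a.moment - b.moment)

/-- The constraints on a pair of components. -/
structure Feasible (σ ξ : ℝ) (a b : Comp) : Prop where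
  norm : ‖a.u‖ ^ 2 + ‖b.u‖ ^ 2 = 1
  pol : ‖a.u‖ ^ 2 - ‖b.u‖ ^ 2 = σ
  disp : a.moment + b.moment = ξ

/-- From `(N + N')² - (N - N')² = 4 N N'`. It makes Cauchy–Schwarz for the hopping term a bound in
`σ` alone. -/
theorem Feasible.two_mul_norm {σ ξ : ℝ} {a b : Comp} (h : Feasible σ ξ a b) :
    2 * ‖a.u‖ * ‖b.u‖ = Real.sqrt (1 - σ ^ 2) := by
  have e : 1 - σ ^ 2 = (2 * ‖a.u‖ * ‖b.u‖) ^ 2 := by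
    rw [← h.pol]
    linear_combination (-(1 + (‖a.u‖ ^ 2 + ‖b.u‖ ^ 2))) * h.norm
  rw [e, Real.sqrt_sq (by positivity)]

/-- The coupling `±μ x` moves the wells to `∓μ/ω²` and lowers each by `μ²/(2ω²)` times its weight;
the weights sum to one. -/
theorem Feasible.le_energy {ω t σ ξ : ℝ} (hω : 0 < ω) (ht : 0 < t) (μ : ℝ) {a b : Comp}
    (h : Feasible σ ξ a b) :
    ω / 2 - t * Real.sqrt (1 - σ ^ 2) - μ ^ 2 / (2 * ω ^ 2) ≤ energy ω t μ a b := by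
  have h1 := a.oscillator_shift_le ω (-μ / ω ^ 2)
  have h2 := b.oscillator_shift_le ω (μ / ω ^ 2)
  have h3 : (⟪a.u, b.u⟫_ℂ).re ≤ ‖a.u‖ * ‖b.u‖ :=
    (Complex.re_le_norm _).trans (norm_inner_le_norm _ _)
  have h4 := h.two_mul_norm
  have h5 := h.norm
  have e1 : ‖a.p‖ ^ 2 + ω ^ 2 * (‖a.q‖ ^ 2 - 2 * (-μ / ω ^ 2) * a.moment +
      (-μ / ω ^ 2) ^ 2 * ‖a.u‖ ^ 2) =
      ‖a.p‖ ^ 2 + ω ^ 2 * ‖a.q‖ ^ 2 + 2 * μ * a.moment + μ ^ 2 / ω ^ 2 * ‖a.u‖ ^ 2 := by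
    field_simp
    ring
  have e2 : ‖b.p‖ ^ 2 + ω ^ 2 * (‖b.q‖ ^ 2 - 2 * (μ / ω ^ 2) * b.moment +
      (μ / ω ^ 2) ^ 2 * ‖b.u‖ ^ 2) =
      ‖b.p‖ ^ 2 + ω ^ 2 * ‖b.q‖ ^ 2 - 2 * μ * b.moment + μ ^ 2 / ω ^ 2 * ‖b.u‖ ^ 2 := by
    field_simp
    ring
  rw [e1] at h1
  rw [e2] at h2
  have e3 : μ ^ 2 / (2 * ω ^ 2) = μ ^ 2 / ω ^ 2 * (‖a.u‖ ^ 2 + ‖b.u‖ ^ 2) / 2 := by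
    rw [h5]
    field_simp
  have e4 : ω = ω * (‖a.u‖ ^ 2 + ‖b.u‖ ^ 2) := by rw [h5, mul_one]
  have h6 := mul_le_mul_of_nonneg_left h3 ht.le
  rw [energy, e3, ← h4]
  linarith

/-- Both components are multiples of one ground state. Their moments vanish, so the coupling is not
felt, and proportionality saturates Cauchy–Schwarz in the hopping term. -/
theorem exists_feasible_energy_eq {ω : ℝ} (hω : 0 < ω) (t : ℝ) {σ : ℝ}
    (hσ : σ ∈ Icc (-1 : ℝ) 1) :
    ∃ a b : Comp, Feasible σ 0 a b ∧
      ∀ μ, energy ω t μ a b = ω / 2 - t * Real.sqrt (1 - σ ^ 2) := by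
  obtain ⟨c, hc, hE⟩ := exists_ground hω
  have hM : c.moment = 0 := Comp.moment_eq_zero_of_ground hω (by rw [hE, hc]; ring)
  have h1 : 0 ≤ (1 + σ) / 2 := by linarith [hσ.1]
  have h2 : 0 ≤ (1 - σ) / 2 := by linarith [hσ.2]
  set α := Real.sqrt ((1 + σ) / 2)
  set β := Real.sqrt ((1 - σ) / 2)
  have hα2 : α ^ 2 = (1 + σ) / 2 := Real.sq_sqrt h1
  have hβ2 : β ^ 2 = (1 - σ) / 2 := Real.sq_sqrt h2
  have hmom : ∀ z : ℝ, (c.smul (z : ℂ)).moment = 0 := by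
    intro z
    simp only [Comp.moment, Comp.smul] at hM ⊢
    rw [inner_smul_left, inner_smul_right, Complex.conj_ofReal, Complex.re_ofReal_mul,
      Complex.re_ofReal_mul, hM]
    simp
  have hu : ∀ z : ℝ, ‖(c.smul (z : ℂ)).u‖ ^ 2 = z ^ 2 := by
    intro z
    rw [Comp.smul, norm_smul, hc, Complex.norm_real, mul_one, Real.norm_eq_abs, sq_abs]
  have hp : ∀ z : ℝ, ‖(c.smul (z : ℂ)).p‖ ^ 2 = z ^ 2 * ‖c.p‖ ^ 2 := by
    intro z
    rw [Comp.smul, norm_smul, mul_pow, Complex.norm_real, Real.norm_eq_abs, sq_abs]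
  have hq : ∀ z : ℝ, ‖(c.smul (z : ℂ)).q‖ ^ 2 = z ^ 2 * ‖c.q‖ ^ 2 := by
    intro z
    rw [Comp.smul, norm_smul, mul_pow, Complex.norm_real, Real.norm_eq_abs, sq_abs]
  have hf : Feasible σ 0 (c.smul (α : ℂ)) (c.smul (β : ℂ)) := by
    refine ⟨?_, ?_, ?_⟩
    · rw [hu, hu, hα2, hβ2]; ring
    · rw [hu, hu, hα2, hβ2]; ring
    · rw [hmom, hmom, add_zero]
  refine ⟨_, _, hf, fun μ => ?_⟩
  have hov : (⟪(c.smul (α : ℂ)).u, (c.smul (β : ℂ)).u⟫_ℂ).re = α * β := by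
    simp only [Comp.smul]
    rw [inner_smul_left, inner_smul_right, Complex.conj_ofReal, Complex.re_ofReal_mul,
      Complex.re_ofReal_mul, Comp.re_inner_self, hc]
    ring
  have h3 := hf.two_mul_norm
  have hn : ∀ z : ℝ, 0 ≤ z → ‖(c.smul (z : ℂ)).u‖ = z := by
    intro z hz
    rw [Comp.smul, norm_smul, hc, Complex.norm_real, mul_one, Real.norm_of_nonneg hz]
  rw [hn α (Real.sqrt_nonneg _), hn β (Real.sqrt_nonneg _)] at h3
  rw [energy, hmom, hmom, hov, hp, hp, hq, hq, hα2, hβ2, ← h3]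
  linear_combination hE / 2

theorem Feasible.coercive {ω t σ ξ : ℝ} (hω : 0 < ω) (ht : 0 < t) (μ : ℝ) {a b : Comp}
    (h : Feasible σ ξ a b) :
    (‖a.p‖ ^ 2 + ‖b.p‖ ^ 2) / 2 + ω ^ 2 / 4 * (‖a.q‖ ^ 2 + ‖b.q‖ ^ 2) ≤
      energy ω t μ a b + t + μ ^ 2 / ω ^ 2 := by
  have hm : ∀ c : Comp, |μ * c.moment| ≤ ω ^ 2 / 4 * ‖c.q‖ ^ 2 + μ ^ 2 / ω ^ 2 * ‖c.u‖ ^ 2 := by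
    intro c
    have h1 : |c.moment| ≤ ‖c.u‖ * ‖c.q‖ :=
      (Complex.abs_re_le_norm _).trans (norm_inner_le_norm _ _)
    rw [abs_mul]
    have h2 : |μ| * |c.moment| ≤ |μ| * (‖c.u‖ * ‖c.q‖) :=
      mul_le_mul_of_nonneg_left h1 (abs_nonneg _)
    -- Weighted AM–GM, with weights chosen so that the coupling consumes only half of the potential
    -- energy over the two components.
    have h3 : 0 ≤ (ω / 2 * ‖c.q‖ - |μ| / ω * ‖c.u‖) ^ 2 := sq_nonneg _
    have h4 : (ω / 2 * ‖c.q‖ - |μ| / ω * ‖c.u‖) ^ 2 = ω ^ 2 / 4 * ‖c.q‖ ^ 2 +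
        μ ^ 2 / ω ^ 2 * ‖c.u‖ ^ 2 - |μ| * (‖c.u‖ * ‖c.q‖) := by
      rw [← sq_abs μ]
      field_simp
      ring
    linarith
  have h3 : (⟪a.u, b.u⟫_ℂ).re ≤ ‖a.u‖ * ‖b.u‖ :=
    (Complex.re_le_norm _).trans (norm_inner_le_norm _ _)
  have h4 : 2 * (⟪a.u, b.u⟫_ℂ).re ≤ 1 := by
    nlinarith [sq_nonneg (‖a.u‖ - ‖b.u‖), h.norm]
  have h5 := mul_le_mul_of_nonneg_left h4 ht.le
  have ha := (abs_le.1 (hm a)).1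
  have hb := (abs_le.1 (hm b)).2
  have e : μ ^ 2 / ω ^ 2 = μ ^ 2 / ω ^ 2 * ‖a.u‖ ^ 2 + μ ^ 2 / ω ^ 2 * ‖b.u‖ ^ 2 := by
    rw [← mul_add, h.norm, mul_one]
  rw [energy]
  linarith

/-- Direct method: coercivity bounds a minimizing sequence, the constraints and the indefinite terms
pass to the limit, and the quadratic terms can only drop. -/
theorem exists_minimizer {ω t σ : ℝ} (hω : 0 < ω) (ht : 0 < t) (μ : ℝ)
    (hσ : σ ∈ Icc (-1 : ℝ) 1) :
    ∃ a b : Comp, Feasible σ 0 a b ∧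
      ∀ a' b' : Comp, Feasible σ 0 a' b' → energy ω t μ a b ≤ energy ω t μ a' b' := by
  let S : Set ℝ := {e | ∃ a b : Comp, Feasible σ 0 a b ∧ energy ω t μ a b = e}
  have hne : S.Nonempty := by
    obtain ⟨a, b, hf, -⟩ := exists_feasible_energy_eq hω t hσ
    exact ⟨_, a, b, hf, rfl⟩
  have hbdd : BddBelow S := by
    refine ⟨ω / 2 - t * Real.sqrt (1 - σ ^ 2) - μ ^ 2 / (2 * ω ^ 2), ?_⟩
    rintro e ⟨a, b, hf, rfl⟩
    exact hf.le_energy hω ht μ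
  obtain ⟨e, -, he, heS⟩ := exists_seq_tendsto_sInf hne hbdd
  choose a b hf hab using heS
  obtain ⟨D, hD⟩ := he.bddAbove_range
  have hD' : ∀ n, e n ≤ D := fun n => hD ⟨n, rfl⟩
  set D₁ := D + t + μ ^ 2 / ω ^ 2
  have hco : ∀ n, (‖(a n).p‖ ^ 2 + ‖(b n).p‖ ^ 2) / 2 +
      ω ^ 2 / 4 * (‖(a n).q‖ ^ 2 + ‖(b n).q‖ ^ 2) ≤ D₁ := by
    intro n
    have h1 := (hf n).coercive hω ht μ
    rw [hab] at h1
    linarith [hD' n]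
  -- Turns bounds on squares into bounds on norms without square roots, so that one `B` serves all
  -- six sequences.
  have hsq : ∀ {x y : ℝ}, x ^ 2 ≤ y → x ≤ 1 + y := by
    intro x y hxy
    nlinarith [sq_nonneg (x - 1)]
  have hD₁ : 0 ≤ D₁ := le_trans (by positivity) (hco 0)
  have hω2 : 0 < ω ^ 2 := by positivity
  have hp : ∀ n, ‖(a n).p‖ ^ 2 ≤ 2 * D₁ ∧ ‖(b n).p‖ ^ 2 ≤ 2 * D₁ := by
    intro n
    have h1 := hco n
    have h2 : 0 ≤ ω ^ 2 / 4 * (‖(a n).q‖ ^ 2 + ‖(b n).q‖ ^ 2) := by positivity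
    constructor <;> nlinarith [sq_nonneg ‖(a n).p‖, sq_nonneg ‖(b n).p‖]
  have hq : ∀ n, ‖(a n).q‖ ^ 2 ≤ 4 / ω ^ 2 * D₁ ∧ ‖(b n).q‖ ^ 2 ≤ 4 / ω ^ 2 * D₁ := by
    intro n
    have h1 := hco n
    have h2 : ω ^ 2 / 4 * (‖(a n).q‖ ^ 2 + ‖(b n).q‖ ^ 2) ≤ D₁ := by
      have : 0 ≤ (‖(a n).p‖ ^ 2 + ‖(b n).p‖ ^ 2) / 2 := by positivity
      linarith
    have h3 : ‖(a n).q‖ ^ 2 + ‖(b n).q‖ ^ 2 ≤ 4 / ω ^ 2 * D₁ := by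
      have h4 := mul_le_mul_of_nonneg_left h2 (show 0 ≤ 4 / ω ^ 2 by positivity)
      have h5 : 4 / ω ^ 2 * (ω ^ 2 / 4 * (‖(a n).q‖ ^ 2 + ‖(b n).q‖ ^ 2)) =
          ‖(a n).q‖ ^ 2 + ‖(b n).q‖ ^ 2 := by field_simp
      linarith
    constructor <;> nlinarith [sq_nonneg ‖(a n).q‖, sq_nonneg ‖(b n).q‖]
  set B := 1 + 1 + 2 * D₁ + 4 / ω ^ 2 * D₁
  have hB4 : 0 ≤ 4 / ω ^ 2 * D₁ := by positivity
  have hu : ∀ n, ‖(a n).u‖ ≤ B ∧ ‖(b n).u‖ ≤ B := by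
    intro n
    have := (hf n).norm
    constructor <;> nlinarith [sq_nonneg ‖(a n).u‖, sq_nonneg ‖(b n).u‖,
      sq_nonneg (‖(a n).u‖ - 1), sq_nonneg (‖(b n).u‖ - 1)]
  have hpB : ∀ n, ‖(a n).p‖ ≤ B ∧ ‖(b n).p‖ ≤ B := fun n =>
    ⟨by linarith [hsq (hp n).1], by linarith [hsq (hp n).2]⟩
  have hqB : ∀ n, ‖(a n).q‖ ≤ B ∧ ‖(b n).q‖ ≤ B := fun n =>
    ⟨by linarith [hsq (hq n).1], by linarith [hsq (hq n).2]⟩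
  obtain ⟨a₀, φ, k, l, hφ, hau, ham, hap, haq, hk, hl⟩ := Comp.exists_limit
    (fun n => (hu n).1) (fun n => (hpB n).1) (fun n => (hqB n).1)
  obtain ⟨b₀, ψ, k', l', hψ, hbu, hbm, hbp, hbq, hk', hl'⟩ := Comp.exists_limit
    (c := fun n => b (φ n)) (fun n => (hu _).2) (fun n => (hpB _).2) (fun n => (hqB _).2)
  have hψt := hψ.tendsto_atTop
  replace hau := hau.comp hψt
  replace ham := ham.comp hψt
  replace hap := hap.comp hψt
  replace haq := haq.comp hψt
  have hN : Tendsto (fun n => ‖(a (φ (ψ n))).u‖ ^ 2) atTop (𝓝 (‖a₀.u‖ ^ 2)) := hau.norm.pow 2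
  have hN' : Tendsto (fun n => ‖(b (φ (ψ n))).u‖ ^ 2) atTop (𝓝 (‖b₀.u‖ ^ 2)) := hbu.norm.pow 2
  have hf₀ : Feasible σ 0 a₀ b₀ := by
    refine ⟨?_, ?_, ?_⟩
    · exact tendsto_nhds_unique (hN.add hN')
        (tendsto_const_nhds.congr fun n => ((hf _).norm).symm)
    · exact tendsto_nhds_unique (hN.sub hN')
        (tendsto_const_nhds.congr fun n => ((hf _).pol).symm)
    · exact tendsto_nhds_unique (ham.add hbm)
        (tendsto_const_nhds.congr fun n => ((hf _).disp).symm)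
  have hlim : Tendsto (fun n => energy ω t μ (a (φ (ψ n))) (b (φ (ψ n)))) atTop
      (𝓝 ((k ^ 2 + k' ^ 2) / 2 + ω ^ 2 / 2 * (l ^ 2 + l' ^ 2) -
        2 * t * (⟪a₀.u, b₀.u⟫_ℂ).re + μ * (a₀.moment - b₀.moment))) := by
    have hin : Tendsto (fun n => (⟪(a (φ (ψ n))).u, (b (φ (ψ n))).u⟫_ℂ).re) atTop
        (𝓝 (⟪a₀.u, b₀.u⟫_ℂ).re) :=
      (Complex.continuous_re.tendsto _).comp (hau.inner hbu)
    exact (((((hap.pow 2).add (hbp.pow 2)).div_const 2).add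
      (((haq.pow 2).add (hbq.pow 2)).const_mul _)).sub (hin.const_mul _)).add
      ((ham.sub hbm).const_mul _)
  have hlim' : Tendsto (fun n => energy ω t μ (a (φ (ψ n))) (b (φ (ψ n)))) atTop (𝓝 (sInf S)) := by
    simp only [hab]
    exact he.comp (hφ.comp hψ).tendsto_atTop
  have heq := tendsto_nhds_unique hlim hlim'
  refine ⟨a₀, b₀, hf₀, fun a' b' hf' => ?_⟩
  have h1 : sInf S ≤ energy ω t μ a' b' := csInf_le hbdd ⟨a', b', hf', rfl⟩
  refine le_trans ?_ h1
  rw [← heq, energy]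
  have e1 := pow_le_pow_left₀ (norm_nonneg _) hk 2
  have e2 := pow_le_pow_left₀ (norm_nonneg _) hk' 2
  have e3 := pow_le_pow_left₀ (norm_nonneg _) hl 2
  have e4 := pow_le_pow_left₀ (norm_nonneg _) hl' 2
  gcongr

theorem exists_nonneg_minimizer {ω t σ : ℝ} (hω : 0 < ω) (ht : 0 < t) (μ : ℝ)
    (hσ : σ ∈ Icc (-1 : ℝ) 1) :
    ∃ a b : Comp, Feasible σ 0 a b ∧
      (∀ a' b' : Comp, Feasible σ 0 a' b' → energy ω t μ a b ≤ energy ω t μ a' b') ∧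
      (∃ f, a.u = absL2 f) ∧ ∃ f, b.u = absL2 f := by
  obtain ⟨a, b, hf, hmin⟩ := exists_minimizer hω ht μ hσ
  obtain ⟨a', ha, ha1, ha2, ha3, ha4⟩ := a.exists_abs
  obtain ⟨b', hb, hb1, hb2, hb3, hb4⟩ := b.exists_abs
  refine ⟨a', b', ⟨?_, ?_, ?_⟩, fun c d hcd => le_trans ?_ (hmin c d hcd), ⟨_, ha⟩, ⟨_, hb⟩⟩
  · rw [ha1, hb1, hf.norm]
  · rw [ha1, hb1, hf.pol]
  · rw [ha4, hb4, hf.disp]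
  · have h := re_inner_le_absL2 a.u b.u
    rw [energy, energy, ha3, hb3, ha4, hb4, ha, hb]
    gcongr

/-! ### Translations -/

theorem Feasible.shift {σ ξ : ℝ} {a b : Comp} (h : Feasible σ ξ a b) (s : ℝ) :
    Feasible σ (ξ - s) (a.shift s) (b.shift s) := by
  refine ⟨?_, ?_, ?_⟩
  · rw [Comp.norm_u_shift, Comp.norm_u_shift, h.norm]
  · rw [Comp.norm_u_shift, Comp.norm_u_shift, h.pol]
  · rw [Comp.moment_shift, Comp.moment_shift]
    linear_combination h.disp - s * h.norm

/-- Kinetic and hopping terms are translation invariant; the others change by amounts that the three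
constraints fix. -/
theorem Feasible.energy_shift {ω t μ σ ξ : ℝ} {a b : Comp} (h : Feasible σ ξ a b) (s : ℝ) :
    energy ω t μ (a.shift s) (b.shift s) =
      energy ω t μ a b + ω ^ 2 / 2 * (s ^ 2 - 2 * s * ξ) - μ * s * σ := by
  rw [energy, energy, Comp.norm_p_shift, Comp.norm_p_shift, Comp.norm_q_shift_sq,
    Comp.norm_q_shift_sq, Comp.moment_shift, Comp.moment_shift]
  have e : ⟪(a.shift s).u, (b.shift s).u⟫_ℂ = ⟪a.u, b.u⟫_ℂ := LinearIsometry.inner_map_map _ _ _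
  rw [e]
  linear_combination ω ^ 2 / 2 * s ^ 2 * h.norm - ω ^ 2 * s * h.disp - μ * s * h.pol

/-- The stationarity condition of a minimizer under relative translations of its components. -/
theorem stationarity {ω t μ σ : ℝ} {a b : Comp} (h : Feasible σ 0 a b)
    (hmin : ∀ a' b' : Comp, Feasible σ 0 a' b' → energy ω t μ a b ≤ energy ω t μ a' b') :
    ω ^ 2 * (a.moment - b.moment) =
      -(μ * (1 - σ ^ 2)) - 4 * t * (⟪a.p, b.u⟫_ℂ).re := by
  set N := ‖a.u‖ ^ 2 with hN
  set N' := ‖b.u‖ ^ 2 with hN'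
  have h1 := h.norm
  have h2 := h.pol
  have h3 := h.disp
  rw [← hN, ← hN'] at h1 h2
  -- Each component moves in proportion to the weight of the other, in opposite directions: the
  -- first moments change by `∓s N N'`, so the total displacement stays zero.
  let A : ℝ → Comp := fun s => a.shift (s * N')
  let C : ℝ → Comp := fun s => b.shift (-(s * N))
  have hf : ∀ s, Feasible σ 0 (A s) (C s) := by
    intro s
    refine ⟨?_, ?_, ?_⟩
    · rw [Comp.norm_u_shift, Comp.norm_u_shift, h.norm]
    · rw [Comp.norm_u_shift, Comp.norm_u_shift, h.pol]
    · rw [Comp.moment_shift, Comp.moment_shift, ← hN, ← hN']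
      linear_combination h3
  let G : ℝ → ℝ := fun s => (‖a.p‖ ^ 2 + ‖b.p‖ ^ 2) / 2 +
    ω ^ 2 / 2 * ((‖a.q‖ ^ 2 - 2 * (s * N') * a.moment + (s * N') ^ 2 * N) +
      (‖b.q‖ ^ 2 - 2 * (-(s * N)) * b.moment + (-(s * N)) ^ 2 * N')) -
    2 * t * (⟪QuantumRabi.shift s a.u, b.u⟫_ℂ).re +
    μ * (a.moment - s * N' * N - (b.moment - -(s * N) * N'))
  have hG : ∀ s, energy ω t μ (A s) (C s) = G s := by
    intro s
    rw [energy, Comp.norm_p_shift, Comp.norm_p_shift, Comp.norm_q_shift_sq,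
      Comp.norm_q_shift_sq, Comp.moment_shift, Comp.moment_shift, ← hN, ← hN']
    have e : ⟪(A s).u, (C s).u⟫_ℂ = ⟪QuantumRabi.shift s a.u, b.u⟫_ℂ := by
      simp only [A, C, Comp.shift]
      -- The overlap depends only on the relative translation `s N' + s N = s`.
      rw [← LinearIsometry.inner_map_map (QuantumRabi.shift (s * N)), shift_shift, shift_shift,
        add_neg_cancel, shift_zero, ← mul_add, h1, mul_one]
    rw [e]
  have hG0 : G 0 = energy ω t μ a b := by
    simp only [G, shift_zero, energy]
    ring
  have hloc : IsLocalMin G 0 := by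
    refine Eventually.of_forall fun s => ?_
    rw [hG0, ← hG]
    exact hmin _ _ (hf s)
  have hin : HasDerivAt (fun s => (⟪QuantumRabi.shift s a.u, b.u⟫_ℂ).re) (⟪a.p, b.u⟫_ℂ).re 0 := by
    have e1 : HasDerivAt (fun s => ⟪QuantumRabi.shift s a.u, b.u⟫_ℂ) ⟪a.p, b.u⟫_ℂ 0 := by
      simpa using HasDerivAt.inner ℂ a.gen (hasDerivAt_const (0 : ℝ) b.u)
    exact (Complex.reCLM.hasFDerivAt.comp_hasDerivAt (0 : ℝ) e1)
  have hid := hasDerivAt_id (0 : ℝ)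
  have hl : ∀ c : ℝ, HasDerivAt (fun s : ℝ => s * c) c 0 := fun c => by
    simpa using hid.mul_const c
  have hpoly : HasDerivAt G (ω ^ 2 / 2 * (-(2 * N') * a.moment + 2 * N * b.moment) -
      2 * t * (⟪a.p, b.u⟫_ℂ).re + μ * (-(N' * N) - N * N')) 0 := by
    have d1 : HasDerivAt (fun s : ℝ => ω ^ 2 / 2 * ((‖a.q‖ ^ 2 - 2 * (s * N') * a.moment +
        (s * N') ^ 2 * N) + (‖b.q‖ ^ 2 - 2 * (-(s * N)) * b.moment + (-(s * N)) ^ 2 * N')))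
        (ω ^ 2 / 2 * (-(2 * N') * a.moment + 2 * N * b.moment)) 0 := by
      have e1 := ((((hl N').const_mul 2).mul_const a.moment).const_sub (‖a.q‖ ^ 2)).add
        (((hl N').pow 2).mul_const N)
      have e2 := ((((hl N).neg.const_mul 2).mul_const b.moment).const_sub (‖b.q‖ ^ 2)).add
        (((hl N).neg.pow 2).mul_const N')
      refine HasDerivAt.congr_deriv ((e1.add e2).const_mul (ω ^ 2 / 2)) ?_
      simp
    have d2 : HasDerivAt (fun s : ℝ => μ * (a.moment - s * N' * N - (b.moment - -(s * N) * N')))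
        (μ * (-(N' * N) - N * N')) 0 := by
      have e1 := ((hl N').mul_const N).const_sub a.moment
      have e2 := ((hl N).neg.mul_const N').const_sub b.moment
      refine HasDerivAt.congr_deriv ((e1.sub e2).const_mul μ) ?_
      ring
    exact ((d1.const_add _).sub (hin.const_mul (2 * t))).add d2
  have hz := hloc.hasDerivAt_eq_zero hpoly
  have hσ : 1 - σ ^ 2 = 4 * N * N' := by
    rw [← h2]
    linear_combination (-(1 + N + N')) * h1
  rw [hσ]
  -- Zero total displacement makes the two moments opposite, so `N' m - N m'` is half of `m - m'`.
  linear_combination (-2) * hz + ω ^ 2 * (a.moment - b.moment) * (-1) * h1 + ω ^ 2 * (N - N') * h3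

/-! ### Integrating a selection of supergradients -/

/-- Comparing the inequality at two points in both orders makes `b` antitone, hence integrable and
continuous off a countable set. There `f' = b`, and `f` is Lipschitz, so the fundamental theorem
with countably many exceptions applies. No measurability of the selection is needed. -/
theorem integral_supergradient {f b : ℝ → ℝ} {l : ℝ} (hl : 0 ≤ l)
    (h : ∀ x ∈ Icc 0 l, ∀ y ∈ Icc 0 l, f y ≤ f x + (y - x) * b x) :
    IntervalIntegrable b volume 0 l ∧ ∫ x in (0 : ℝ)..l, b x = f l - f 0 := by
  have hanti : AntitoneOn b (Icc 0 l) := by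
    intro x hx y hy hxy
    rcases hxy.eq_or_lt with rfl | hlt
    · rfl
    · have h1 := h x hx y hy
      have h2 := h y hy x hx
      nlinarith
  have hint : IntervalIntegrable b volume 0 l := by
    apply AntitoneOn.intervalIntegrable
    rwa [uIcc_of_le hl]
  refine ⟨hint, ?_⟩
  -- The supergradients at `x` and `y` sandwich the increment of `f`, so the linearization error is
  -- `o(y - x)` wherever `b` is continuous.
  have hdiff : ∀ x ∈ Icc 0 l, ∀ y ∈ Icc 0 l,
      |f y - f x - (y - x) * b x| ≤ |(y - x) * (b y - b x)| := by
    intro x hx y hy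
    have h1 := h x hx y hy
    have h2 := h y hy x hx
    have h3 : (y - x) * (b y - b x) ≤ 0 := by nlinarith
    rw [abs_of_nonpos (by linarith), abs_of_nonpos h3]
    nlinarith
  refine integral_eq_of_hasDerivAt_off_countable_of_le f b hl
    hanti.countable_not_continuousWithinAt ?_ ?_ hint
  · have h0 : (0 : ℝ) ∈ Icc 0 l := ⟨le_rfl, hl⟩
    have hl' : l ∈ Icc 0 l := ⟨hl, le_rfl⟩
    refine (LipschitzOnWith.of_dist_le_mul (K := ⟨|b 0| + |b l|, by positivity⟩) ?_).continuousOn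
    have hb : ∀ z ∈ Icc 0 l, |b z| ≤ |b 0| + |b l| := by
      intro z hz
      have h1 := hanti h0 hz hz.1
      have h2 := hanti hz hl' hz.2
      rw [abs_le]
      constructor
      · linarith [neg_abs_le (b l), abs_nonneg (b 0)]
      · linarith [le_abs_self (b 0), abs_nonneg (b l)]
    intro x hx y hy
    rw [Real.dist_eq, Real.dist_eq]
    change _ ≤ (|b 0| + |b l|) * |x - y|
    have h1 := h x hx y hy
    have h2 := h y hy x hx
    have h3 : |(x - y) * b x| ≤ (|b 0| + |b l|) * |x - y| := by
      rw [abs_mul, mul_comm]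
      exact mul_le_mul_of_nonneg_right (hb x hx) (abs_nonneg _)
    have h4 : |(x - y) * b y| ≤ (|b 0| + |b l|) * |x - y| := by
      rw [abs_mul, mul_comm]
      exact mul_le_mul_of_nonneg_right (hb y hy) (abs_nonneg _)
    rw [abs_le] at h3 h4 ⊢
    constructor <;> nlinarith [h3.1, h3.2, h4.1, h4.2]
  · rintro x ⟨hx, hxc⟩
    have hxI : x ∈ Icc 0 l := Ioo_subset_Icc_self hx
    have hnhds : Icc 0 l ∈ 𝓝 x := Icc_mem_nhds hx.1 hx.2
    have hcont : ContinuousAt b x := by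
      by_contra hc
      refine hxc ⟨hxI, fun hw => hc (hw.continuousAt hnhds)⟩
    rw [hasDerivAt_iff_isLittleO]
    have hb0 : (fun y => b y - b x) =o[𝓝 x] fun _ => (1 : ℝ) := by
      rw [Asymptotics.isLittleO_one_iff]
      simpa using hcont.tendsto.sub_const (b x)
    have hprod := (Asymptotics.isBigO_refl (fun y => y - x) (𝓝 x)).mul_isLittleO hb0
    simp only [mul_one] at hprod
    refine Asymptotics.IsBigO.trans_isLittleO ?_ hprod
    refine Asymptotics.IsBigO.of_bound 1 ?_
    filter_upwards [hnhds] with y hy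
    rw [one_mul, Real.norm_eq_abs, Real.norm_eq_abs, smul_eq_mul]
    exact hdiff x hxI y hy

/-! ### Wave functions and components -/

theorem FiniteEnergy.exists_comp {f : ℝ → ℂ} (h : FiniteEnergy f) :
    ∃ c : Comp, f =ᵐ[volume] c.u := by
  obtain ⟨h1, ⟨f', h2, h3⟩, h4⟩ := h
  refine ⟨⟨h1.toLp, h3.toLp, h4.toLp, ?_, ?_⟩, h1.coeFn_toLp.symm⟩
  · exact (h2.congr h1.coeFn_toLp.symm h3.coeFn_toLp.symm).hasGen
  · unfold IsMulX
    filter_upwards [h1.coeFn_toLp, h4.coeFn_toLp] with x e1 e2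
    rw [e1, e2]

namespace Comp

variable {c : Comp} {f : ℝ → ℂ}

theorem isWeakDeriv (h : f =ᵐ[volume] c.u) : IsWeakDeriv f c.p :=
  c.gen.isWeakDeriv.congr h.symm (ae_eq_refl _)

theorem finiteEnergy (h : f =ᵐ[volume] c.u) : FiniteEnergy f := by
  refine ⟨(Lp.memLp c.u).ae_eq h.symm, ⟨c.p, isWeakDeriv h, Lp.memLp c.p⟩,
    (Lp.memLp c.q).ae_eq ?_⟩
  filter_upwards [h, c.mul] with x h1 h2
  rw [h2, h1]

theorem integral_norm_sq (h : f =ᵐ[volume] c.u) : ∫ x, ‖f x‖ ^ 2 = ‖c.u‖ ^ 2 := by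
  rw [norm_sq_eq_integral]
  refine integral_congr_ae ?_
  filter_upwards [h] with x h1
  rw [h1]

theorem mul_norm_sq_ae (h : f =ᵐ[volume] c.u) :
    (fun x => (⟪c.u x, c.q x⟫_ℂ).re) =ᵐ[volume] fun x => x * ‖f x‖ ^ 2 := by
  filter_upwards [h, c.mul] with x h1 h2
  rw [h1, h2]
  simp only [RCLike.inner_apply]
  rw [mul_assoc, Complex.mul_conj, Complex.normSq_eq_norm_sq, ← Complex.ofReal_mul,
    Complex.ofReal_re]

theorem integrable_mul_norm_sq (h : f =ᵐ[volume] c.u) : Integrable fun x => x * ‖f x‖ ^ 2 :=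
  (L2.integrable_inner (𝕜 := ℂ) c.u c.q).re.congr (mul_norm_sq_ae h)

theorem integral_mul_norm_sq (h : f =ᵐ[volume] c.u) : ∫ x, x * ‖f x‖ ^ 2 = c.moment := by
  rw [← integral_congr_ae (mul_norm_sq_ae h), moment, L2.inner_def]
  exact integral_re (L2.integrable_inner (𝕜 := ℂ) c.u c.q)

theorem sq_mul_norm_sq_ae (h : f =ᵐ[volume] c.u) :
    (fun x => ‖c.q x‖ ^ 2) =ᵐ[volume] fun x => x ^ 2 * ‖f x‖ ^ 2 := by
  filter_upwards [h, c.mul] with x h1 h2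
  rw [h1, h2, norm_mul, mul_pow, Complex.norm_real, Real.norm_eq_abs, sq_abs]

theorem integrable_sq_mul_norm_sq (h : f =ᵐ[volume] c.u) :
    Integrable fun x => x ^ 2 * ‖f x‖ ^ 2 :=
  (integrable_norm_sq c.q).congr (sq_mul_norm_sq_ae h)

theorem integral_sq_mul_norm_sq (h : f =ᵐ[volume] c.u) :
    ∫ x, x ^ 2 * ‖f x‖ ^ 2 = ‖c.q‖ ^ 2 := by
  rw [← integral_congr_ae (sq_mul_norm_sq_ae h), norm_sq_eq_integral]

end Comp

/-- The components `a`, `b` represent the wave function `ψ`. -/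
structure Represents (ψ : Wavefunction) (a b : Comp) : Prop where
  plus : ψ.plus =ᵐ[volume] a.u
  minus : ψ.minus =ᵐ[volume] b.u

namespace Represents

variable {ψ : Wavefunction} {a b : Comp}

theorem displacement (h : Represents ψ a b) : ψ.displacement = a.moment + b.moment := by
  rw [Wavefunction.displacement, ← Comp.integral_mul_norm_sq h.plus,
    ← Comp.integral_mul_norm_sq h.minus, ← integral_add (Comp.integrable_mul_norm_sq h.plus)
    (Comp.integrable_mul_norm_sq h.minus)]
  simp only [mul_add]

theorem expSigmaZX (h : Represents ψ a b) : ψ.expSigmaZX = a.moment - b.moment := by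
  rw [Wavefunction.expSigmaZX, ← Comp.integral_mul_norm_sq h.plus,
    ← Comp.integral_mul_norm_sq h.minus, ← integral_sub (Comp.integrable_mul_norm_sq h.plus)
    (Comp.integrable_mul_norm_sq h.minus)]
  simp only [mul_sub]

theorem expXSq (h : Represents ψ a b) : ψ.expXSq = ‖a.q‖ ^ 2 + ‖b.q‖ ^ 2 := by
  rw [Wavefunction.expXSq, ← Comp.integral_sq_mul_norm_sq h.plus,
    ← Comp.integral_sq_mul_norm_sq h.minus,
    ← integral_add (Comp.integrable_sq_mul_norm_sq h.plus)
    (Comp.integrable_sq_mul_norm_sq h.minus)]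
  simp only [mul_add]

theorem expPSq (h : Represents ψ a b) : ψ.expPSq = ‖a.p‖ ^ 2 + ‖b.p‖ ^ 2 := by
  rw [Wavefunction.expPSq, norm_sq_eq_integral, norm_sq_eq_integral,
    ← integral_add (integrable_norm_sq a.p) (integrable_norm_sq b.p)]
  refine integral_congr_ae ?_
  filter_upwards [(Comp.isWeakDeriv h.plus).weakDeriv_ae_eq,
    (Comp.isWeakDeriv h.minus).weakDeriv_ae_eq] with x h1 h2
  rw [h1, h2]

theorem expSigmaX (h : Represents ψ a b) : ψ.expSigmaX = 2 * (⟪a.u, b.u⟫_ℂ).re := by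
  rw [Wavefunction.expSigmaX, L2.inner_def]
  congr 2
  refine integral_congr_ae ?_
  filter_upwards [h.plus, h.minus] with x h1 h2
  rw [h1, h2, RCLike.inner_apply, mul_comm]

theorem internalEnergy (h : Represents ψ a b) (ω t g l : ℝ) :
    internalEnergy ω t g l ψ = energy ω t (l * g) a b := by
  rw [QuantumRabi.internalEnergy, h.expPSq, h.expXSq, h.expSigmaX, h.expSigmaZX, energy]
  ring

theorem mem_constraintManifold (h : Represents ψ a b) {σ ξ : ℝ} :
    ψ ∈ constraintManifold σ ξ ↔ Feasible σ ξ a b := by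
  have h1 : ψ.normSq = ‖a.u‖ ^ 2 + ‖b.u‖ ^ 2 := by
    rw [Wavefunction.normSq, Comp.integral_norm_sq h.plus, Comp.integral_norm_sq h.minus]
  have h2 : ψ.polarization = ‖a.u‖ ^ 2 - ‖b.u‖ ^ 2 := by
    rw [Wavefunction.polarization, Comp.integral_norm_sq h.plus, Comp.integral_norm_sq h.minus]
  constructor
  · rintro ⟨-, e1, e2, e3⟩
    exact ⟨h1 ▸ e1, h2 ▸ e2, h.displacement ▸ e3⟩
  · rintro ⟨e1, e2, e3⟩
    exact ⟨⟨Comp.finiteEnergy h.plus, Comp.finiteEnergy h.minus⟩, h1.trans e1, h2.trans e2,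
      h.displacement.trans e3⟩

/-- The inner product conjugates its first slot; after conjugating the whole pairing, reality of
`ψ₋` removes the remaining conjugate. -/
theorem hoppingOverlap (h : Represents ψ a b) (hr : ψ.RealNonneg) :
    hoppingOverlap ψ = (⟪a.p, b.u⟫_ℂ).re := by
  rw [QuantumRabi.hoppingOverlap, ← Complex.conj_re ⟪a.p, b.u⟫_ℂ, L2.inner_def, ← integral_conj]
  congr 1
  refine integral_congr_ae ?_
  filter_upwards [(Comp.isWeakDeriv h.plus).weakDeriv_ae_eq, h.minus, hr.2] with x h1 h2 h3
  rw [h2] at h3 ⊢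
  rw [h1, RCLike.inner_apply, map_mul, Complex.conj_conj, Complex.conj_eq_iff_im.2 h3.1, mul_comm]

end Represents

theorem represents_mk (a b : Comp) : Represents ⟨a.u, b.u⟩ a b :=
  ⟨ae_eq_refl _, ae_eq_refl _⟩

theorem exists_represents {σ ξ : ℝ} {ψ : Wavefunction} (h : ψ ∈ constraintManifold σ ξ) :
    ∃ a b, Represents ψ a b := by
  obtain ⟨a, ha⟩ := h.1.1.exists_comp
  obtain ⟨b, hb⟩ := h.1.2.exists_comp
  exact ⟨a, b, ha, hb⟩

/-! ### Optimizers and the value of the Levy–Lieb functional -/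

theorem absL2_real_nonneg (f : L2) : ∀ᵐ x : ℝ, (absL2 f x).im = 0 ∧ 0 ≤ (absL2 f x).re := by
  filter_upwards [absL2_coeFn f] with x hx
  rw [hx]
  simp

theorem exists_isOptimizer {ω t σ : ℝ} (hω : 0 < ω) (ht : 0 < t) (g ν : ℝ)
    (hσ : σ ∈ Icc (-1 : ℝ) 1) : ∃ ψ, IsOptimizer ω t g ν σ 0 ψ := by
  obtain ⟨a, b, hf, hmin, ⟨f₁, h₁⟩, f₂, h₂⟩ := exists_nonneg_minimizer hω ht (ν * g) hσ
  refine ⟨⟨a.u, b.u⟩, (represents_mk a b).mem_constraintManifold.2 hf, fun χ hχ => ?_, ?_, ?_⟩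
  · obtain ⟨a', b', hr⟩ := exists_represents hχ
    rw [(represents_mk a b).internalEnergy, hr.internalEnergy]
    exact hmin a' b' (hr.mem_constraintManifold.1 hχ)
  · rw [h₁]
    exact absL2_real_nonneg f₁
  · rw [h₂]
    exact absL2_real_nonneg f₂

/-- A minimizing pair of components at zero displacement. -/
def IsMinimizer (ω t μ σ : ℝ) (a b : Comp) : Prop :=
  Feasible σ 0 a b ∧ ∀ a' b' : Comp, Feasible σ 0 a' b' → energy ω t μ a b ≤ energy ω t μ a' b'

theorem IsOptimizer.exists_isMinimizer {ω t g l σ : ℝ} {ψ : Wavefunction}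
    (h : IsOptimizer ω t g l σ 0 ψ) :
    ∃ a b, Represents ψ a b ∧ IsMinimizer ω t (l * g) σ a b := by
  obtain ⟨a, b, hr⟩ := exists_represents h.1
  refine ⟨a, b, hr, hr.mem_constraintManifold.1 h.1, fun a' b' hf => ?_⟩
  rw [← hr.internalEnergy, ← (represents_mk a' b').internalEnergy]
  exact h.2.1 _ ((represents_mk a' b').mem_constraintManifold.2 hf)

theorem IsMinimizer.levyLieb_eq {ω t g l σ : ℝ} {a b : Comp}
    (h : IsMinimizer ω t (l * g) σ a b) (ξ : ℝ) :
    levyLieb ω t g l σ ξ = energy ω t (l * g) a b + ω ^ 2 / 2 * ξ ^ 2 + l * g * ξ * σ := by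
  have h1 : Feasible σ ξ (a.shift (-ξ)) (b.shift (-ξ)) := by
    simpa using h.1.shift (-ξ)
  have h2 := h.1.energy_shift (ω := ω) (t := t) (μ := l * g) (-ξ)
  refine IsLeast.csInf_eq ⟨⟨⟨(a.shift (-ξ)).u, (b.shift (-ξ)).u⟩, ?_, ?_⟩, ?_⟩
  · exact (represents_mk _ _).mem_constraintManifold.2 h1
  · rw [(represents_mk _ _).internalEnergy, h2]
    ring
  · rintro e ⟨χ, hχ, rfl⟩
    obtain ⟨a', b', hr⟩ := exists_represents hχ
    have hf := hr.mem_constraintManifold.1 hχ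
    have h3 : Feasible σ 0 (a'.shift ξ) (b'.shift ξ) := by
      simpa using hf.shift ξ
    have h4 := h.2 _ _ h3
    rw [hf.energy_shift] at h4
    rw [hr.internalEnergy]
    linarith

/-! ### Exchange and correlation energies -/

theorem IsMinimizer.energy_le {ω t μ σ : ℝ} (hω : 0 < ω) (hσ : σ ∈ Icc (-1 : ℝ) 1) {a b : Comp}
    (h : IsMinimizer ω t μ σ a b) :
    energy ω t μ a b ≤ ω / 2 - t * Real.sqrt (1 - σ ^ 2) := by
  obtain ⟨a', b', hf, he⟩ := exists_feasible_energy_eq hω t hσ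
  exact (h.2 a' b' hf).trans (he μ).le

theorem energy_add_coupling (ω t μ ν : ℝ) (a b : Comp) :
    energy ω t ν a b = energy ω t μ a b + (ν - μ) * (a.moment - b.moment) := by
  rw [energy, energy]
  ring

/-- At zero coupling a minimizer attains the lower bound, yet must obey it at every coupling `ν`.
With `Δ` the moment difference, `ν = -ω² Δ` gives `ω² Δ² / 2 ≤ 0`. -/
theorem IsMinimizer.moment_sub_eq_zero {ω t σ : ℝ} (hω : 0 < ω) (ht : 0 < t)
    (hσ : σ ∈ Icc (-1 : ℝ) 1) {a b : Comp} (h : IsMinimizer ω t 0 σ a b) :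
    a.moment - b.moment = 0 := by
  have h1 := h.energy_le hω hσ
  have h2 := h.1.le_energy hω ht (-(ω ^ 2 * (a.moment - b.moment)))
  rw [energy_add_coupling ω t 0] at h2
  have e : (-(ω ^ 2 * (a.moment - b.moment))) ^ 2 / (2 * ω ^ 2) =
      ω ^ 2 * (a.moment - b.moment) ^ 2 / 2 := by
    field_simp
  rw [e] at h2
  have h3 : ω ^ 2 * (a.moment - b.moment) ^ 2 ≤ 0 := by nlinarith
  have h4 : 0 < ω ^ 2 := by positivity
  exact (pow_eq_zero_iff two_ne_zero).1
    (le_antisymm (nonpos_of_mul_nonpos_right h3 h4) (sq_nonneg _))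

theorem isExchangeEnergy_zero {ω t σ : ℝ} (hω : 0 < ω) (ht : 0 < t) (g : ℝ)
    (hσ : σ ∈ Icc (-1 : ℝ) 1) (ξ : ℝ) : IsExchangeEnergy ω t g σ ξ 0 := by
  have hmin : ∀ μ, ∃ a b : Comp, IsMinimizer ω t μ σ a b := fun μ => by
    obtain ⟨a, b, h1, h2⟩ := exists_minimizer hω ht μ hσ
    exact ⟨a, b, h1, h2⟩
  choose a b hab using hmin
  refine ⟨g * σ * ξ, ?_, by rw [directTerm, sub_self]⟩
  rw [tendsto_iff_norm_sub_tendsto_zero]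
  have hlim : Tendsto (fun l : ℝ => l * (g ^ 2 / (2 * ω ^ 2))) (𝓝[>] 0) (𝓝 0) := by
    have : Tendsto (fun l : ℝ => l * (g ^ 2 / (2 * ω ^ 2))) (𝓝 0)
      (𝓝 (0 * (g ^ 2 / (2 * ω ^ 2)))) := tendsto_id.mul_const _
    rw [zero_mul] at this
    exact this.mono_left nhdsWithin_le_nhds
  refine squeeze_zero' (Eventually.of_forall fun _ => norm_nonneg _) ?_ hlim
  filter_upwards [self_mem_nhdsWithin] with l hl
  have hl0 : 0 < l := hl
  have h0 := hab (0 * g)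
  have h1 := hab (l * g)
  rw [h1.levyLieb_eq, h0.levyLieb_eq]
  have e0 := h0.energy_le hω hσ
  have e0' := h0.1.le_energy hω ht (0 * g)
  have e1 := h1.energy_le hω hσ
  have e1' := h1.1.le_energy hω ht (l * g)
  set E₁ := energy ω t (l * g) (a (l * g)) (b (l * g))
  set E₀ := energy ω t (0 * g) (a (0 * g)) (b (0 * g))
  have e2 : (0 * g) ^ 2 / (2 * ω ^ 2) = 0 := by simp
  have e3 : (l * g) ^ 2 / (2 * ω ^ 2) = l * (g ^ 2 / (2 * ω ^ 2)) * l := by ring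
  rw [e2] at e0'
  rw [e3] at e1'
  have e4 : (E₁ + ω ^ 2 / 2 * ξ ^ 2 + l * g * ξ * σ -
      (E₀ + ω ^ 2 / 2 * ξ ^ 2 + 0 * g * ξ * σ)) / l - g * σ * ξ = (E₁ - E₀) / l := by
    field_simp
    ring
  -- The two-sided bounds give `|E₁ - E₀| ≤ l² g² / (2ω²)`, one power of `l` more than the quotient
  -- needs.
  rw [e4, Real.norm_eq_abs, abs_div, abs_of_pos hl0, div_le_iff₀ hl0, abs_le]
  constructor
  · linarith
  · have : 0 ≤ l * (g ^ 2 / (2 * ω ^ 2)) * l := by positivity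
    linarith

theorem correlationEnergy_eq {ω t σ : ℝ} (hω : 0 < ω) (ht : 0 < t) (g : ℝ)
    (hσ : σ ∈ Icc (-1 : ℝ) 1) {l : ℝ} (hl : 0 ≤ l) {φ : ℝ → Wavefunction}
    (hφ : ∀ ν ∈ Icc 0 l, IsOptimizer ω t g ν σ 0 (φ ν)) :
    IntervalIntegrable (fun ν => hoppingOverlap (φ ν)) volume 0 l ∧
      ∀ ξ, correlationEnergy ω t g l σ ξ =
        -(l ^ 2 * g ^ 2 / (2 * ω ^ 2)) * (1 - σ ^ 2) + correlationIntegral ω t g φ l := by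
  have hex : ∀ ν, ∃ a b : Comp, ν ∈ Icc 0 l →
      Represents (φ ν) a b ∧ IsMinimizer ω t (ν * g) σ a b := by
    intro ν
    by_cases hν : ν ∈ Icc 0 l
    · obtain ⟨a, b, h⟩ := (hφ ν hν).exists_isMinimizer
      exact ⟨a, b, fun _ => h⟩
    -- Outside `[0, l]` any pair will do; it only makes the choice total.
    · obtain ⟨a, b, -⟩ := exists_feasible_energy_eq hω t hσ
      exact ⟨a, b, fun h => absurd h hν⟩
  choose a b hab using hex
  let f : ℝ → ℝ := fun ν => energy ω t (ν * g) (a ν) (b ν)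
  let d : ℝ → ℝ := fun ν => g * ((a ν).moment - (b ν).moment)
  have hsuper : ∀ x ∈ Icc 0 l, ∀ y ∈ Icc 0 l, f y ≤ f x + (y - x) * d x := by
    intro x hx y hy
    -- The minimizer at `x` serves as a trial state at `y`, and the energy is affine in the
    -- coupling.
    have h1 := (hab y hy).2.2 _ _ (hab x hx).2.1
    rw [energy_add_coupling ω t (x * g) (y * g) (a x) (b x)] at h1
    simp only [f, d]
    linarith
  obtain ⟨hint, hval⟩ := integral_supergradient hl hsuper
  have hstat : ∀ ν ∈ Icc 0 l, ω ^ 2 * ((a ν).moment - (b ν).moment) =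
      -(ν * g * (1 - σ ^ 2)) - 4 * t * hoppingOverlap (φ ν) := by
    intro ν hν
    obtain ⟨hr, hm⟩ := hab ν hν
    rw [hr.hoppingOverlap (hφ ν hν).2.2]
    exact stationarity hm.1 hm.2
  refine ⟨?_, fun ξ => ?_⟩
  -- The supergradient carries a factor `g`. For `g ≠ 0` stationarity recovers the hopping overlap
  -- from it; for `g = 0` the moment difference, and hence the overlap, vanishes.
  · by_cases hg : g = 0
    · have h0 : IntervalIntegrable (fun _ : ℝ => (0 : ℝ)) volume 0 l := by simp
      refine h0.congr ?_
      rw [uIoc_of_le hl]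
      intro ν hν
      have hν' := Ioc_subset_Icc_self hν
      have h1 := hstat ν hν'
      have h2 := (hab ν hν').2
      rw [hg, mul_zero] at h1 h2
      rw [h2.moment_sub_eq_zero hω ht hσ] at h1
      have h3 : t * hoppingOverlap (φ ν) = 0 := by linarith
      exact ((mul_eq_zero.1 h3).resolve_left ht.ne').symm
    · have h0 : IntervalIntegrable (fun ν : ℝ => -(ω ^ 2 / (4 * t * g)) * d ν -
          ν * (g * (1 - σ ^ 2) / (4 * t))) volume 0 l :=
        (hint.const_mul _).sub (Continuous.intervalIntegrable (by fun_prop) _ _)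
      refine h0.congr ?_
      rw [uIoc_of_le hl]
      intro ν hν
      have h1 := hstat ν (Ioc_subset_Icc_self hν)
      simp only [d]
      field_simp
      linarith
  · have h0 := (hab 0 ⟨le_rfl, hl⟩).2
    have h1 := (hab l ⟨hl, le_rfl⟩).2
    -- Stationarity times `g / ω²`: the integrand of `I` is the supergradient plus a term linear in
    -- `ν`, whose integral is the explicit quadratic part.
    have h2 : correlationIntegral ω t g φ l =
        ∫ ν in (0 : ℝ)..l, (d ν + ν * (g ^ 2 * (1 - σ ^ 2) / ω ^ 2)) := by
      rw [correlationIntegral, ← intervalIntegral.integral_const_mul]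
      refine intervalIntegral.integral_congr fun ν hν => ?_
      rw [uIcc_of_le hl] at hν
      have h3 := hstat ν hν
      simp only [d]
      field_simp
      linear_combination (-g) * h3
    rw [h2, intervalIntegral.integral_add hint (Continuous.intervalIntegrable (by fun_prop) _ _),
      hval, intervalIntegral.integral_mul_const, integral_id, correlationEnergy, directTerm,
      h1.levyLieb_eq, h0.levyLieb_eq]
    simp only [f]
    field_simp
    ring

end QuantumRabi

theorem mainTheorem5 (ω t g : ℝ) (hω : 0 < ω) (ht : 0 < t) (σ : ℝ) (hσ : σ ∈ Set.Icc (-1 : ℝ) 1) :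
    -- the exchange energy exists and vanishes
    (∀ ξ : ℝ, QuantumRabi.IsExchangeEnergy ω t g σ ξ 0) ∧
    -- the optimizers that enter the correlation integral exist
    (∀ ν : ℝ, ∃ ψ, QuantumRabi.IsOptimizer ω t g ν σ 0 ψ) ∧
    -- the formula for the correlation energy, for every choice of these optimizers
    (∀ l : ℝ, 0 ≤ l → ∀ φ : ℝ → QuantumRabi.Wavefunction,
      (∀ ν ∈ Set.Icc 0 l, QuantumRabi.IsOptimizer ω t g ν σ 0 (φ ν)) →
        IntervalIntegrable (fun ν => QuantumRabi.hoppingOverlap (φ ν)) MeasureTheory.volume 0 l ∧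
        ∀ ξ : ℝ, QuantumRabi.correlationEnergy ω t g l σ ξ =
          -(l ^ 2 * g ^ 2 / (2 * ω ^ 2)) * (1 - σ ^ 2) +
            QuantumRabi.correlationIntegral ω t g φ l) := by
  refine ⟨fun ξ => QuantumRabi.isExchangeEnergy_zero hω ht g hσ ξ,
    fun ν => QuantumRabi.exists_isOptimizer hω ht g ν hσ, fun l hl φ hφ =>
    QuantumRabi.correlationEnergy_eq hω ht g hσ hl hφ⟩
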